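/- \textbf{Definitions.} A \emph{set sequence equipped with embeddings} (ssee) $\mathbf V$ is a sequence $(V_n)_{n\in\mathbb N}$ of finite sets together with, for every $N\le n$, a collection $\binom{V_n}{V_N}$ of injections $\phi:V_N\to V_n$ (called embeddings). Let $I(N,n)$ be the number of pairs $(\phi_1,\phi_2)$ of embeddings of $V_N$ into $V_n$ with $1<|\phi_1(V_N)\cap\phi_2(V_N)|<|V_N|$. The ssee is \emph{good} if $|V_n|\to\infty$ and, for every $N$ with $|V_N|>1$, \[\left|\tbinom{V_n}{V_N}\right|\Big/|V_n|\to\infty\quad\text{and}\quad |V_n|\,I(N,n)\Big/\left|\tbinom{V_n}{V_N}\right|^2\to 0\qquad(n\to\infty).\] For a finite set $V$, let $\mathrm{vol}$ be Lebesgue measure on $[0,1]^V$. A \emph{box} in $[0,1]^V$ is a product $\prod_{i\in V}A_i$ of measurable sets $A_i\subseteq[0,1]$. The \emph{entropy} of a measurable set $b\subseteq[0,1]^V$ is $\mathrm{Ent}(b)=-\log\mathrm{vol}(b)\in[0,\infty]$. For an embedding $\phi\in\binom{V_n}{V_N}$ and measurable $b\subseteq[0,1]^{V_n}$, the strict projection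 $b_{\downarrow\phi}\subseteq[0,1]^{V_N}$ is the set of those $c\in[0,1]^{V_N}$ for which the slice $\{\tilde c\in b:\tilde c_{\phi(i)}=c_i\ \forall i\in V_N\}$ has positive $|V_n\setminus\phi(V_N)|$-dimensional volume. A \emph{$[0,1]$-decoration property} of $\mathbf V$ is a sequence $\mathcal P=(\mathcal P_n)_{n\in\mathbb N}$ of measurable sets $\mathcal P_n\subseteq[0,1]^{V_n}$. It is \emph{hereditary} if for all $N\le n$, every $\phi\in\binom{V_n}{V_N}$ and every $c\in[0,1]^{V_n}$ such that $(c_{\phi(i)})_{i\in V_N}\notin\mathcal P_N$, we have $c\notin\mathcal P_n$. Its \emph{extremal entropy} is \[\mathrm{ex}(V_n,\mathcal P_n)=\inf\{\mathrm{Ent}(b): b\text{ a box in }[0,1]^{V_n},\ \mathrm{vol}(b\setminus\mathcal P_n)=0\}\in[0,\infty].\] \textbf{Statement.} Let $\mathbf V$ be a good ssee and let $\mathcal P$ be a hereditary $[0,1]$-decoration property of $\mathbf V$. Suppose that (a) the limit $\pi(\mathcal P):=\lim_{n\to\infty}\mathrm{ex}(V_n,\mathcal P_n)/|V_n|$ exists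 as a (finite) real number; (b) for every $\varepsilon>0$ there exist $\eta>0$ and positive integers $N\le n_0$ such that for every $n\ge n_0$ and every box $b$ in $[0,1]^{V_n}$: if $\mathbb E_\phi\,\mathrm{vol}(b_{\downarrow\phi}\setminus\mathcal P_N)<\eta$, where $\phi$ is uniformly random in $\binom{V_n}{V_N}$ (the expectation being read as $0$ if there are no embeddings), then $\mathrm{Ent}(b)>(\pi(\mathcal P)-\varepsilon)|V_n|$. Then \[\mathrm{vol}(\mathcal P_n)=e^{-(\pi(\mathcal P)+o(1))|V_n|}\qquad(n\to\infty),\] that is, there is a real sequence $(o_n)$ with $o_n\to0$ such that $\mathrm{vol}(\mathcal P_n)=e^{-(\pi(\mathcal P)+o_n)|V_n|}$ for all sufficiently large $n$. -/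

import Mathlib

open Filter Topology MeasureTheory

universe u

noncomputable section

/-- A set sequence equipped with embeddings (ssee): a sequence of finite sets `V n`, together with
a collection `emb N n` of injections `V N → V n`. Only the collections with `N ≤ n` are ever
used. -/
structure SSEE where
  /-- the sets of the sequence -/
  V : ℕ → Type u
  /-- each of them is finite -/
  fintypeV : ∀ n, Fintype (V n)
  /-- the embeddings of `V N` into `V n` -/
  emb : ∀ N n : ℕ, Finset (V N ↪ V n)

namespace SSEE

instance (S : SSEE.{u}) (n : ℕ) : Fintype (S.V n) := S.fintypeV n

/-- The number of `i`-intersecting embeddings of `(V N₁, V N₂)` into `V n`. A map on the disjoint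
union `V N₁ ⊔ V N₂` is written as the pair of its two restrictions. -/
def intersectingCount (S : SSEE.{u}) (i N₁ N₂ n : ℕ) : ℕ :=
  Set.ncard {p : (S.V N₁ ↪ S.V n) × (S.V N₂ ↪ S.V n) |
    p.1 ∈ S.emb N₁ n ∧ p.2 ∈ S.emb N₂ n ∧ (Set.range p.1 ∩ Set.range p.2).ncard = i}

/-- `I(N, n)`: the number of pairs of embeddings of `V N` into `V n` that share more than one and
fewer than `|V N|` elements. -/
def intersectingSum (S : SSEE.{u}) (N n : ℕ) : ℕ :=
  ∑ i ∈ Finset.Ioo 1 (Fintype.card (S.V N)), S.intersectingCount i N N n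

/-- Good ssee-s. -/
structure IsGood (S : SSEE.{u}) : Prop where
  card_tendsto : Tendsto (fun n => Fintype.card (S.V n)) atTop atTop
  many_embeddings : ∀ N, 1 < Fintype.card (S.V N) →
    Tendsto (fun n => ((S.emb N n).card : ℝ) / (Fintype.card (S.V n) : ℝ)) atTop atTop
  few_intersecting : ∀ N, 1 < Fintype.card (S.V N) →
    Tendsto (fun n => ((Fintype.card (S.V n) : ℝ) * (S.intersectingSum N n : ℝ)) /
      ((S.emb N n).card : ℝ) ^ 2) atTop (𝓝 0)

end SSEE

/-- `[0,1]`-decorations of `V`, i.e. points of the cube `[0,1]^V`. It carries the product of the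
Lebesgue measures of its factors. -/
abbrev Decoration (V : Type u) : Type u := V → unitInterval

/-- Boxes: products of measurable subsets of `[0,1]`. -/
def IsBox {V : Type u} (b : Set (Decoration V)) : Prop :=
  ∃ A : V → Set unitInterval, (∀ i, MeasurableSet (A i)) ∧ b = {c | ∀ i, c i ∈ A i}

/-- `Ent b = - log (vol b)`, which is `+∞` when `vol b = 0`. -/
def entropy {V : Type u} [Fintype V] (b : Set (Decoration V)) : EReal :=
  -ENNReal.log (volume b)

open Classical in
/-- The strict projection `b_{↓φ}`: the points `c` for which the slice
`{x ∈ b | x (φ i) = c i for all i}` has positive volume in the coordinates outside `φ(W)`. -/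
def projection {W V : Type u} [Fintype V] (φ : W ↪ V) (b : Set (Decoration V)) :
    Set (Decoration W) :=
  {c | 0 < volume ((fun (x : Decoration V) (j : {j : V // j ∉ Set.range φ}) => x j.1) ''
    {x | x ∈ b ∧ ∀ i, x (φ i) = c i})}

/-- The lift `b_{↑φ}`. -/
def lift {W V : Type u} (φ : W ↪ V) (b : Set (Decoration W)) : Set (Decoration V) :=
  {c | ∃ c' ∈ b, ∀ i, c' i = c (φ i)}

/-- The upper shadow of `b ⊆ [0,1]^{V N}` in `[0,1]^{V n}`. -/
def upperShadow (S : SSEE.{u}) {N : ℕ} (n : ℕ) (b : Set (Decoration (S.V N))) :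
    Set (Decoration (S.V n)) :=
  ⋃ φ ∈ S.emb N n, lift φ b

/-- A `[0,1]`-decoration property: a sequence of measurable sets `P n ⊆ [0,1]^{V n}`. -/
structure DecorationProperty (S : SSEE.{u}) where
  body : ∀ n, Set (Decoration (S.V n))
  measurableSet_body : ∀ n, MeasurableSet (body n)

/-- A property is hereditary if its complement is closed under taking upper shadows. -/
def DecorationProperty.IsHereditary {S : SSEE.{u}} (P : DecorationProperty S) : Prop :=
  ∀ N n : ℕ, N ≤ n → upperShadow S n (P.body N)ᶜ ⊆ (P.body n)ᶜ

/-- The extremal entropy `ex(V, Q)` of `Q ⊆ [0,1]^V`: the infimum of the entropies of the boxes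
that lie in `Q` up to a null set. -/
def extremalEntropy {V : Type u} [Fintype V] (Q : Set (Decoration V)) : EReal :=
  sInf {e | ∃ b : Set (Decoration V), IsBox b ∧ volume (b \ Q) = 0 ∧ e = entropy b}

/-- The expectation over a uniformly random embedding `φ` of `V N` into `V n` of
`vol (b_{↓φ} \ Q)`; it is `0` if there are no embeddings. -/
def expectedExcess (S : SSEE.{u}) (N n : ℕ) (b : Set (Decoration (S.V n)))
    (Q : Set (Decoration (S.V N))) : ℝ :=
  (∑ φ ∈ S.emb N n, (volume (projection φ b \ Q)).toReal) / ((S.emb N n).card : ℝ)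

end

/-! The lower bound is immediate: a box lying in P_n up to a null set, of nearly minimal entropy,
already has volume at least e^{-(π+ε)|V_n|}. The content is the upper bound. For it, the values on a
set S of coordinates are fixed, and most of P = P_n is then covered by a box to which (b) applies,
up to few exceptional coordinates.

Draw z uniformly from P and condition on its values on S. The box consists of the values of each
coordinate that have conditional density above τ. If a point of the box restricts along φ to a point
outside P_N, then by heredity the joint density of the coordinates along φ vanishes there. Revealing
these coordinates one at a time, the conditional density of some coordinate must drop from above τ
(given S) to at most τ/2. Such drops are charged to an energy: the average of 1/(1+f), where f is
the conditional density of a coordinate i given S. By convexity it increases with S, it is at most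
vol P, and it grows by a definite amount with the measure of the drops (`energy_increment`,
`integral_likelySet_le`). Hence if adding a typical link φ(V_N) \ {φ(k)} to S hardly raises the
energy of φ(k), the box has small mean excess and (b) bounds its volume.

Such an S, met by few embeddings, maximises the total energy minus a multiple of the number of
embeddings that meet it (`exists_cheap_stable_set`). By maximality a sparse random set R raises the
energy little. Goodness makes most pairs of links at a common vertex disjoint, so by a second moment
argument the number of links inside R concentrates, and adding a typical link gains little more than
adding R.

Finally, each coordinate of z is unlikely with probability at most τ. By Markov's inequality most of
P has few unlikely coordinates in a suitable weighting, and admitting these costs only a factor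
e^{o(1)|V_n|} as τ → 0 (`volume_fewExceptions_le`). Integrating over the values on S gives the bound
(`volume_le_of_boxes_le`). -/

section Marginals

/-! ### Marginal densities and the energy of a coordinate. -/

theorem measurable_finset_piecewise {V : Type u} [DecidableEq V] (W : Finset V) :
    Measurable (fun p : Decoration V × Decoration V => W.piecewise p.1 p.2) := by
  refine measurable_pi_lambda _ fun i => ?_
  by_cases hi : i ∈ W
  · simp only [Finset.piecewise_eq_of_mem _ _ _ hi]
    fun_prop
  · simp only [Finset.piecewise_eq_of_notMem _ _ _ hi]
    fun_prop

variable {V : Type u} [Fintype V] [DecidableEq V]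

/-- Exchanging the coordinates in `W` between two independent uniform decorations preserves their
joint law. -/
theorem measurePreserving_exchange (W : Finset V) :
    MeasurePreserving (fun p : Decoration V × Decoration V =>
      (W.piecewise p.2 p.1, W.piecewise p.1 p.2)) (volume.prod volume) (volume.prod volume) := by
  have h1 := measurePreserving_arrowProdEquivProdArrow unitInterval unitInterval V
    (fun _ => (volume : Measure unitInterval)) (fun _ => (volume : Measure unitInterval))
  have h2 : MeasurePreserving
      (fun (a : V → unitInterval × unitInterval) i => if i ∈ W then (a i).swap else a i)
      (Measure.pi fun _ => volume.prod volume) (Measure.pi fun _ => volume.prod volume) := by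
    refine measurePreserving_pi
      (f := fun i (a : unitInterval × unitInterval) => if i ∈ W then a.swap else a) _ _ fun i => ?_
    by_cases hi : i ∈ W
    · simpa [hi] using Measure.measurePreserving_swap
    · simp only [hi, if_false]
      exact MeasurePreserving.id _
  have h3 := (h1.comp h2).comp (h1.symm (MeasurableEquiv.arrowProdEquivProdArrow _ _ _))
  refine (congrArg (fun f => MeasurePreserving f (volume.prod volume) (volume.prod volume)) ?_).mp h3
  funext p
  refine Prod.ext ?_ ?_ <;> funext i <;> by_cases hi : i ∈ W <;>
    simp [hi, MeasurableEquiv.arrowProdEquivProdArrow, Equiv.arrowProdEquivProdArrow]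

theorem measurePreserving_finset_piecewise (W : Finset V) :
    MeasurePreserving (fun p : Decoration V × Decoration V => W.piecewise p.1 p.2)
      (volume.prod volume) volume :=
  measurePreserving_snd.comp (measurePreserving_exchange W)

/-- The marginal density of the coordinates in `S`, for the restriction of Lebesgue measure to
`P`. -/
noncomputable def marginalDensity (P : Set (Decoration V)) (S : Finset V) (x : Decoration V) : ℝ :=
  volume.real {z | S.piecewise x z ∈ P}

variable {P : Set (Decoration V)} {S T : Finset V}

theorem marginalDensity_nonneg (x : Decoration V) : 0 ≤ marginalDensity P S x :=
  measureReal_nonneg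

theorem marginalDensity_le_one (x : Decoration V) : marginalDensity P S x ≤ 1 :=
  measureReal_le_one

theorem measurable_marginalDensity (hP : MeasurableSet P) (S : Finset V) :
    Measurable (marginalDensity P S) :=
  (measurable_measure_prodMk_left (measurable_finset_piecewise S hP)).ennreal_toReal

theorem marginalDensity_congr {x y : Decoration V} (h : ∀ i ∈ S, x i = y i) :
    marginalDensity P S x = marginalDensity P S y := by
  have : ∀ z, S.piecewise x z = S.piecewise y z := fun z =>
    Finset.piecewise_congr S h fun _ _ => rfl
  simp [marginalDensity, this]

theorem marginalDensity_eq_integral (hP : MeasurableSet P) (x : Decoration V) :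
    marginalDensity P S x = ∫ z, P.indicator (fun _ => (1 : ℝ)) (S.piecewise x z) := by
  have hm : MeasurableSet {z | S.piecewise x z ∈ P} :=
    (measurable_finset_piecewise S).comp (measurable_prodMk_left (x := x)) hP
  rw [marginalDensity, ← integral_indicator_one hm]
  rfl

theorem marginalDensity_univ (x : Decoration V) :
    marginalDensity P Finset.univ x = P.indicator (fun _ => (1 : ℝ)) x := by
  by_cases hx : x ∈ P <;> simp [marginalDensity, hx]

theorem integrable_of_measurable_of_abs_le {Ω : Type*} [MeasurableSpace Ω] {μ : Measure Ω}
    [IsFiniteMeasure μ] {f : Ω → ℝ} (hf : Measurable f) {C : ℝ} (hC : ∀ x, |f x| ≤ C) :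
    Integrable f μ :=
  Integrable.of_bound hf.aestronglyMeasurable C (Eventually.of_forall hC)

theorem MeasureTheory.MeasurePreserving.integral_comp_of_measurable {Ω Ω' : Type*}
    [MeasurableSpace Ω] [MeasurableSpace Ω'] {μ : Measure Ω} {ν : Measure Ω'} {φ : Ω → Ω'}
    (hφ : MeasurePreserving φ μ ν) {f : Ω' → ℝ} (hf : Measurable f) :
    ∫ x, f (φ x) ∂μ = ∫ y, f y ∂ν := by
  rw [← hφ.map_eq, integral_map hφ.aemeasurable hf.aestronglyMeasurable]

/-- Integrating out the coordinates in `T \ S`. -/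
theorem integral_mul_marginalDensity (hP : MeasurableSet P) (hST : S ⊆ T)
    {h : Decoration V → ℝ} (hm : Measurable h) {C : ℝ} (hC : ∀ x, |h x| ≤ C)
    (hind : ∀ x y, (∀ i, i ∉ T \ S → x i = y i) → h x = h y) :
    ∫ x, h x * marginalDensity P T x = ∫ x, h x * marginalDensity P S x := by
  have key : ∀ U : Finset V, ∫ x, h x * marginalDensity P U x =
      ∫ p : Decoration V × Decoration V,
        h p.1 * P.indicator (fun _ => (1 : ℝ)) (U.piecewise p.1 p.2) ∂(volume.prod volume) := by
    intro U
    rw [integral_prod]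
    · refine integral_congr_ae (Eventually.of_forall fun x => ?_)
      simp only
      rw [integral_const_mul, marginalDensity_eq_integral hP]
    · refine integrable_of_measurable_of_abs_le (C := C * 1) ?_ fun p => ?_
      · exact (hm.comp measurable_fst).mul
          ((measurable_const.indicator hP).comp (measurable_finset_piecewise U))
      · rw [abs_mul]
        refine mul_le_mul (hC _) ?_ (abs_nonneg _) ((abs_nonneg _).trans (hC p.1))
        by_cases hx : U.piecewise p.1 p.2 ∈ P <;> simp [hx]
  -- Exchanging the coordinates in T \ S between the two decorations turns the T-mixture into the
  -- S-mixture and does not affect h.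
  rw [key, key, ← (measurePreserving_exchange (T \ S)).integral_comp_of_measurable]
  · refine integral_congr_ae (Eventually.of_forall fun p => ?_)
    simp only
    congr 1
    · exact hind _ _ fun i hi => Finset.piecewise_eq_of_notMem _ _ _ hi
    · congr 1
      funext i
      by_cases h1 : i ∈ S
      · simp [h1, hST h1]
      · by_cases h2 : i ∈ T <;> simp [h1, h2]
  · exact (hm.comp measurable_fst).mul
      ((measurable_const.indicator hP).comp (measurable_finset_piecewise T))

theorem integral_marginalDensity (hP : MeasurableSet P) (S : Finset V) :
    ∫ x, marginalDensity P S x = volume.real P := by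
  have h := integral_mul_marginalDensity hP (Finset.subset_univ S) (h := fun _ => 1)
    measurable_const (C := 1) (by simp) (fun _ _ _ => rfl)
  simp only [one_mul, marginalDensity_univ] at h
  rw [← h]
  exact (integral_indicator_one hP)

/-- The average over the coordinates in `S` of a convex function of the conditional density of the
coordinate `i`. -/
noncomputable def energy (P : Set (Decoration V)) (i : V) (S : Finset V) : ℝ :=
  ∫ x, marginalDensity P S x ^ 2 / (marginalDensity P S x + marginalDensity P (insert i S) x)

theorem sq_div_add_nonneg_le {a b : ℝ} (ha : 0 ≤ a) (hb : 0 ≤ b) :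
    0 ≤ a ^ 2 / (a + b) ∧ a ^ 2 / (a + b) ≤ a := by
  refine ⟨by positivity, ?_⟩
  rcases ha.eq_or_lt with rfl | h
  · simp
  · rw [div_le_iff₀ (by positivity)]
    nlinarith

theorem measurable_energy_integrand (hP : MeasurableSet P) (i : V) (S : Finset V) :
    Measurable fun x =>
      marginalDensity P S x ^ 2 / (marginalDensity P S x + marginalDensity P (insert i S) x) := by
  have h1 := measurable_marginalDensity hP S
  have h2 := measurable_marginalDensity hP (insert i S)
  fun_prop

theorem abs_energy_integrand_le (i : V) (S : Finset V) (x : Decoration V) :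
    |marginalDensity P S x ^ 2 / (marginalDensity P S x + marginalDensity P (insert i S) x)| ≤ 1 := by
  have h := sq_div_add_nonneg_le (marginalDensity_nonneg (P := P) (S := S) x)
    (marginalDensity_nonneg (P := P) (S := insert i S) x)
  rw [abs_of_nonneg h.1]
  exact h.2.trans (marginalDensity_le_one x)

theorem integrable_marginalDensity (hP : MeasurableSet P) (S : Finset V) :
    Integrable (marginalDensity P S) volume :=
  integrable_of_measurable_of_abs_le (measurable_marginalDensity hP S) (C := 1) fun x => by
    rw [abs_of_nonneg (marginalDensity_nonneg x)]
    exact marginalDensity_le_one x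

theorem energy_nonneg (i : V) : 0 ≤ energy P i S :=
  integral_nonneg fun x =>
    (sq_div_add_nonneg_le (marginalDensity_nonneg x) (marginalDensity_nonneg x)).1

/-- In terms of the conditional density f, the integrand is the marginal density times 1/(1+f). This
convex function is bounded although f need not be, which is why it is used rather than a square. -/
theorem energy_le (hP : MeasurableSet P) (i : V) : energy P i S ≤ volume.real P := by
  rw [← integral_marginalDensity hP S]
  refine integral_mono (integrable_of_measurable_of_abs_le (measurable_energy_integrand hP i S)
    (abs_energy_integrand_le i S)) (integrable_marginalDensity hP S) fun x => ?_
  exact (sq_div_add_nonneg_le (marginalDensity_nonneg x) (marginalDensity_nonneg x)).2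

/-- The function c²/(c+d) is convex and homogeneous of degree 1; the left side is its tangent plane
along the ray c/(c+d) = p. The difference of the two sides is (c - p(c+d))²/(c+d). -/
theorem energy_tangent_le {p c d : ℝ} (hc : 0 ≤ c) (hd : 0 ≤ d) :
    2 * p * c - p ^ 2 * (c + d) ≤ c ^ 2 / (c + d) := by
  rcases (add_nonneg hc hd).eq_or_lt with h | h
  · rw [← h]
    have : c = 0 := by linarith
    simp [this]
  · rw [le_div_iff₀ h]
    nlinarith [sq_nonneg (c - p * (c + d))]

/-- The condition on p says that d/c ≥ τ on the ray of tangency, while d/c ≤ τ/2 at the point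
itself. Hence c - p(c+d) ≥ τc/4, and c+d ≤ 3c/2 turns its square into a gain of (τ²/16)(2/3)c =
τ²c/24. -/
theorem energy_tangent_add_le {p c d τ : ℝ} (hc : 0 ≤ c) (hd : 0 ≤ d) (hτ : 0 ≤ τ) (hτ1 : τ ≤ 1)
    (hp0 : 0 ≤ p) (hp : p * (1 + τ) ≤ 1) (hdc : d ≤ τ / 2 * c) :
    2 * p * c - p ^ 2 * (c + d) + τ ^ 2 / 24 * c ≤ c ^ 2 / (c + d) := by
  rcases hc.eq_or_lt with rfl | hc'
  · have := energy_tangent_le (p := p) hc hd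
    simpa using this
  have hw : 0 < c + d := by linarith
  have h1 : c * (τ / 4) ≤ c - p * (c + d) := by
    have h2 : p * (c + d) ≤ p * ((1 + τ / 2) * c) :=
      mul_le_mul_of_nonneg_left (by linarith) hp0
    have h3 : p * (1 + τ / 2) ≤ 1 - τ / 4 := by nlinarith
    nlinarith [mul_le_mul_of_nonneg_right h3 hc]
  have h4 : (c * (τ / 4)) ^ 2 ≤ (c - p * (c + d)) ^ 2 := by
    have : 0 ≤ c * (τ / 4) := by positivity
    gcongr
  have h5 : τ ^ 2 / 24 * c * (c + d) ≤ (c * (τ / 4)) ^ 2 := by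
    have : c + d ≤ 3 / 2 * c := by nlinarith
    calc τ ^ 2 / 24 * c * (c + d) ≤ τ ^ 2 / 24 * c * (3 / 2 * c) := by gcongr
      _ = (c * (τ / 4)) ^ 2 := by ring
  rw [le_div_iff₀ hw]
  nlinarith

end Marginals

/-- `S` together with the images of the first `k` points under `e`. -/
def chainSet {V : Type u} [DecidableEq V] {r : ℕ} (e : Fin r → V) (S : Finset V) (k : ℕ) : Finset V :=
  S ∪ (Finset.univ.filter fun j : Fin r => j.val < k).image e

theorem chainSet_zero {V : Type u} [DecidableEq V] {r : ℕ} (e : Fin r → V) (S : Finset V) : chainSet e S 0 = S := by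
  simp [chainSet]

theorem chainSet_succ {V : Type u} [DecidableEq V] {r : ℕ} (e : Fin r → V) (S : Finset V) (k : Fin r) :
    chainSet e S (k + 1) = insert (e k) (chainSet e S k) := by
  ext v
  simp only [chainSet, Finset.mem_union, Finset.mem_image, Finset.mem_filter, Finset.mem_univ,
    true_and, Finset.mem_insert]
  constructor
  · rintro (h | ⟨j, hj, rfl⟩)
    · exact Or.inr (Or.inl h)
    · rcases (Nat.lt_succ_iff.1 hj).eq_or_lt with h | h
      · left; rw [Fin.ext h]
      · exact Or.inr (Or.inr ⟨j, h, rfl⟩)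
  · rintro (rfl | h | ⟨j, hj, rfl⟩)
    · exact Or.inr ⟨k, Nat.lt_succ_self _, rfl⟩
    · exact Or.inl h
    · exact Or.inr ⟨j, Nat.lt_succ_of_lt hj, rfl⟩

/-! ### Energy increments from drops of conditional densities. -/

section Increment

variable {V : Type u} [Fintype V] [DecidableEq V] {P : Set (Decoration V)} {S T : Finset V}

/-- The points at which the conditional density of the coordinate `i`, given the coordinates in
`S`, is above `τ`, but drops to at most `τ / 2` once the coordinates in `T` are given. -/
def dropSet (P : Set (Decoration V)) (S T : Finset V) (i : V) (τ : ℝ) : Set (Decoration V) :=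
  {x | τ * marginalDensity P S x < marginalDensity P (insert i S) x ∧
    marginalDensity P (insert i T) x ≤ τ / 2 * marginalDensity P T x}

theorem measurableSet_dropSet (hP : MeasurableSet P) (S T : Finset V) (i : V) (τ : ℝ) :
    MeasurableSet (dropSet P S T i τ) := by
  have h := measurable_marginalDensity hP
  exact (measurableSet_lt ((h S).const_mul τ) (h _)).inter
    (measurableSet_le (h _) ((h T).const_mul _))

/-- Jensen's inequality with a gain: averaged over the coordinates in T \ S, the conditional density
given T becomes the one given S, and at a point of the drop set the two differ by a factor of at
least 2. -/
theorem energy_increment (hP : MeasurableSet P) (hST : S ⊆ T) {i : V} (hi : i ∉ T) {τ : ℝ}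
    (hτ : 0 ≤ τ) (hτ1 : τ ≤ 1) :
    energy P i S + τ ^ 2 / 24 * ∫ x, (dropSet P S T i τ).indicator (marginalDensity P T) x ≤
      energy P i T := by
  set a := marginalDensity P S with ha
  set b := marginalDensity P (insert i S) with hb
  set c := marginalDensity P T with hc
  set d := marginalDensity P (insert i T) with hd
  have am : Measurable a := measurable_marginalDensity hP S
  have bm : Measurable b := measurable_marginalDensity hP _
  have cm : Measurable c := measurable_marginalDensity hP T
  have dm : Measurable d := measurable_marginalDensity hP _
  have a0 : ∀ x, 0 ≤ a x := fun x => marginalDensity_nonneg x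
  have b0 : ∀ x, 0 ≤ b x := fun x => marginalDensity_nonneg x
  have c0 : ∀ x, 0 ≤ c x := fun x => marginalDensity_nonneg x
  have d0 : ∀ x, 0 ≤ d x := fun x => marginalDensity_nonneg x
  -- Tangent planes are taken at (a, b). Their slopes depend only on the coordinates in S and on i,
  -- so c and d can be integrated down to a and b, and the tangent parts add up to the energy at S.
  set p : Decoration V → ℝ := fun x => a x / (a x + b x) with hp
  have pm : Measurable p := by fun_prop
  have p0 : ∀ x, 0 ≤ p x := fun x => div_nonneg (a0 x) (add_nonneg (a0 x) (b0 x))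
  have p1 : ∀ x, p x ≤ 1 := fun x =>
    div_le_one_of_le₀ (by linarith [b0 x]) (add_nonneg (a0 x) (b0 x))
  have pind : ∀ x y, (∀ j, j ∉ T \ S → x j = y j) → p x = p y := by
    intro x y hxy
    have h1 : a x = a y := marginalDensity_congr fun j hj => hxy j (by simp [hj])
    have h2 : b x = b y := marginalDensity_congr fun j hj => hxy j (by
      rcases Finset.mem_insert.1 hj with rfl | h
      · simp [hi]
      · simp [h])
    simp [hp, h1, h2]
  set u : Decoration V → ℝ := fun x => 2 * p x - p x ^ 2 with hu
  set w : Decoration V → ℝ := fun x => -p x ^ 2 with hw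
  have um : Measurable u := by fun_prop
  have wm : Measurable w := by fun_prop
  have u1 : ∀ x, |u x| ≤ 1 := fun x => abs_le.2 ⟨by nlinarith [p0 x, p1 x], by nlinarith [p0 x, p1 x]⟩
  have w1 : ∀ x, |w x| ≤ 1 := fun x => abs_le.2 ⟨by nlinarith [p0 x, p1 x], by nlinarith [p0 x, p1 x]⟩
  have e1 : ∫ x, u x * c x = ∫ x, u x * a x :=
    integral_mul_marginalDensity hP hST um u1 fun x y h => by simp [hu, pind x y h]
  have e2 : ∫ x, w x * d x = ∫ x, w x * b x := by
    refine integral_mul_marginalDensity hP (Finset.insert_subset_insert i hST) wm w1 fun x y h => ?_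
    have : p x = p y := pind x y fun j hj => h j fun hj' => hj (by
      simp only [Finset.mem_sdiff, Finset.mem_insert, not_or] at hj' ⊢
      exact ⟨hj'.1.resolve_left hj'.2.1, hj'.2.2⟩)
    simp [hw, this]
  have int : ∀ {f g : Decoration V → ℝ}, Measurable f → (∀ x, |f x| ≤ 1) → Measurable g →
      (∀ x, 0 ≤ g x) → (∀ x, g x ≤ 1) → Integrable (fun x => f x * g x) volume := by
    intro f g fm f1 gm g0 g1
    refine integrable_of_measurable_of_abs_le (fm.mul gm) (C := 1) fun x => ?_
    rw [abs_mul, abs_of_nonneg (g0 x)]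
    exact mul_le_one₀ (f1 x) (g0 x) (g1 x)
  have iuc := int um u1 cm c0 fun x => marginalDensity_le_one x
  have iua := int um u1 am a0 fun x => marginalDensity_le_one x
  have iwd := int wm w1 dm d0 fun x => marginalDensity_le_one x
  have iwb := int wm w1 bm b0 fun x => marginalDensity_le_one x
  have iB : Integrable (fun x => (dropSet P S T i τ).indicator c x) volume :=
    (integrable_marginalDensity hP T).indicator (measurableSet_dropSet hP S T i τ)
  have iucd : Integrable (fun x => u x * c x + w x * d x) volume := iuc.add iwd
  have eS : energy P i S = ∫ x, (u x * a x + w x * b x) := by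
    refine integral_congr_ae (Eventually.of_forall fun x => ?_)
    show a x ^ 2 / (a x + b x) = u x * a x + w x * b x
    simp only [hu, hw, hp]
    rcases (add_nonneg (a0 x) (b0 x)).eq_or_lt with h | h
    · simp [← h]
    · field_simp
      ring
  rw [eS, integral_add iua iwb, ← e1, ← e2, ← integral_add iuc iwd, ← integral_const_mul,
    ← integral_add iucd (iB.const_mul _)]
  refine integral_mono (iucd.add (iB.const_mul _))
    (integrable_of_measurable_of_abs_le (measurable_energy_integrand hP i T)
      (abs_energy_integrand_le i T)) fun x => ?_
  show u x * c x + w x * d x + τ ^ 2 / 24 * (dropSet P S T i τ).indicator c x ≤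
    c x ^ 2 / (c x + d x)
  have eq : u x * c x + w x * d x = 2 * p x * c x - p x ^ 2 * (c x + d x) := by
    simp only [hu, hw]
    ring
  rw [eq]
  by_cases hx : x ∈ dropSet P S T i τ
  · rw [Set.indicator_of_mem hx]
    refine energy_tangent_add_le (c0 x) (d0 x) hτ hτ1 (p0 x) ?_ hx.2
    have hx1 : τ * a x < b x := hx.1
    rw [hp, div_mul_eq_mul_div]
    refine div_le_one_of_le₀ (by nlinarith) (add_nonneg (a0 x) (b0 x))
  · rw [Set.indicator_of_notMem hx, mul_zero, add_zero]
    exact energy_tangent_le (c0 x) (d0 x)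

theorem energy_mono (hP : MeasurableSet P) (hST : S ⊆ T) {i : V} (hi : i ∉ T) :
    energy P i S ≤ energy P i T := by
  simpa using energy_increment hP hST hi le_rfl zero_le_one

/-- For a sequence that starts positive and reaches 0 at r the second alternative fails, so there is
a drop. The bound on g k ensures that not too much mass was lost before it. -/
theorem exists_drop_of_eq_zero {t : ℝ} (ht : 0 ≤ t) {g : ℕ → ℝ} (r : ℕ) :
    (∃ k < r, g (k + 1) ≤ t * g k ∧ t ^ k * g 0 ≤ g k) ∨ t ^ r * g 0 ≤ g r := by
  induction r with
  | zero => simp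
  | succ r ih =>
    rcases ih with ⟨k, hk, h⟩ | h
    · exact Or.inl ⟨k, hk.trans (Nat.lt_succ_self r), h⟩
    · by_cases h' : g (r + 1) ≤ t * g r
      · exact Or.inl ⟨r, Nat.lt_succ_self r, h', h⟩
      · right
        calc t ^ (r + 1) * g 0 = t * (t ^ r * g 0) := by ring
          _ ≤ t * g r := mul_le_mul_of_nonneg_left h ht
          _ ≤ g (r + 1) := (not_le.1 h').le

/-- The points of `F` all of whose coordinates in the range of `e` have conditional density
above `τ` given the coordinates in `S`. -/
def likelySet (P : Set (Decoration V)) (S : Finset V) {r : ℕ} (e : Fin r → V) (τ : ℝ)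
    (F : Set (Decoration V)) : Set (Decoration V) :=
  {x | x ∈ F ∧ ∀ k, τ * marginalDensity P S x < marginalDensity P (insert (e k) S) x}

theorem measurableSet_likelySet (hP : MeasurableSet P) (S : Finset V) {r : ℕ} (e : Fin r → V)
    (τ : ℝ) {F : Set (Decoration V)} (hF : MeasurableSet F) :
    MeasurableSet (likelySet P S e τ F) := by
  have h := measurable_marginalDensity hP
  have : likelySet P S e τ F = F ∩ ⋂ k,
      {x | τ * marginalDensity P S x < marginalDensity P (insert (e k) S) x} := by
    ext x
    simp [likelySet]
  rw [this]
  exact hF.inter (MeasurableSet.iInter fun k => measurableSet_lt ((h S).const_mul τ) (h _))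

/-- Along the chain that adds the points e k to S one by one, the density of a point of F falls to
0, so some step is a drop. Summing over the possible steps, (2/τ)^r pays for the density lost before
the drop and 24/τ² converts drops into energy. -/
theorem integral_likelySet_le (hP : MeasurableSet P) {r : ℕ} {e : Fin r → V}
    (he : Function.Injective e) (heS : ∀ k, e k ∉ S) {F : Set (Decoration V)}
    (hF : MeasurableSet F) (hFP : ∀ x ∈ F, ∀ z, (∀ k, z (e k) = x (e k)) → z ∉ P) {τ : ℝ}
    (hτ : 0 < τ) (hτ1 : τ ≤ 1) :
    ∫ x, (likelySet P S e τ F).indicator (marginalDensity P S) x ≤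
      (2 / τ) ^ r * (24 / τ ^ 2) *
        ∑ k, (energy P (e k) (S ∪ (Finset.univ.image e).erase (e k)) - energy P (e k) S) := by
  have hdrop : ∀ k : Fin r, Integrable
      ((dropSet P S (chainSet e S k) (e k) τ).indicator (marginalDensity P (chainSet e S k)))
      volume := fun k => (integrable_marginalDensity hP _).indicator (measurableSet_dropSet hP ..)
  have hmeas := measurableSet_likelySet hP S e τ hF
  have hτ2 : 1 ≤ 2 / τ := by rw [le_div_iff₀ hτ]; linarith
  have hpt : ∀ x, (likelySet P S e τ F).indicator (marginalDensity P S) x ≤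
      ∑ k : Fin r, (2 / τ) ^ r *
        (dropSet P S (chainSet e S k) (e k) τ).indicator
          (marginalDensity P (chainSet e S k)) x := by
    intro x
    have hnn : ∀ k : Fin r, 0 ≤ (2 / τ) ^ r * (dropSet P S (chainSet e S k) (e k) τ).indicator
        (marginalDensity P (chainSet e S k)) x := fun k =>
      mul_nonneg (by positivity) (Set.indicator_nonneg (fun y _ => marginalDensity_nonneg y) x)
    by_cases hx : x ∈ likelySet P S e τ F
    swap
    · rw [Set.indicator_of_notMem hx]
      exact Finset.sum_nonneg fun k _ => hnn k
    rw [Set.indicator_of_mem hx]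
    rcases exists_drop_of_eq_zero (t := τ / 2) (by positivity)
      (g := fun k => marginalDensity P (chainSet e S k) x) r with ⟨k, hk, h1, h2⟩ | h
    · rw [chainSet_zero] at h2
      refine le_trans ?_ (Finset.single_le_sum (fun k _ => hnn k) (Finset.mem_univ ⟨k, hk⟩))
      have hmem : x ∈ dropSet P S (chainSet e S k) (e ⟨k, hk⟩) τ := by
        refine ⟨hx.2 _, ?_⟩
        have := chainSet_succ e S ⟨k, hk⟩
        simp only at this
        rw [← this]
        exact h1
      rw [Set.indicator_of_mem hmem]
      calc marginalDensity P S x = (2 / τ) ^ k * ((τ / 2) ^ k * marginalDensity P S x) := by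
            rw [← mul_assoc, ← mul_pow, div_mul_div_cancel₀ hτ.ne', div_self two_ne_zero, one_pow,
              one_mul]
        _ ≤ (2 / τ) ^ k * marginalDensity P (chainSet e S k) x := by gcongr
        _ ≤ (2 / τ) ^ r * marginalDensity P (chainSet e S k) x := by
            refine mul_le_mul_of_nonneg_right ?_ (marginalDensity_nonneg x)
            exact pow_le_pow_right₀ hτ2 hk.le
    -- The full chain fixes every coordinate e k, so no completion lies in P; without a drop the
    -- density was already 0 at the start.
    · have h0 : marginalDensity P (chainSet e S r) x = 0 := by
        have : {z | (chainSet e S r).piecewise x z ∈ P} = ∅ := by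
          refine Set.eq_empty_of_forall_notMem fun z hz => hFP x hx.1 _ (fun k => ?_) hz
          exact Finset.piecewise_eq_of_mem _ _ _ (Finset.mem_union_right _
            (Finset.mem_image_of_mem e (by simp)))
        simp [marginalDensity, this]
      simp only [h0, chainSet_zero] at h
      refine le_trans ?_ (Finset.sum_nonneg fun k _ => hnn k)
      exact nonpos_of_mul_nonpos_right h (by positivity)
  calc ∫ x, (likelySet P S e τ F).indicator (marginalDensity P S) x
      ≤ ∫ x, ∑ k : Fin r, (2 / τ) ^ r * (dropSet P S (chainSet e S k) (e k) τ).indicator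
          (marginalDensity P (chainSet e S k)) x :=
        integral_mono ((integrable_marginalDensity hP S).indicator hmeas)
          (integrable_finsetSum _ fun k _ => (hdrop k).const_mul _) hpt
    _ = ∑ k : Fin r, (2 / τ) ^ r * ∫ x, (dropSet P S (chainSet e S k) (e k) τ).indicator
          (marginalDensity P (chainSet e S k)) x := by
        rw [integral_finsetSum _ fun k _ => (hdrop k).const_mul _]
        simp_rw [integral_const_mul]
    _ ≤ ∑ k : Fin r, (2 / τ) ^ r * (24 / τ ^ 2 *
          (energy P (e k) (S ∪ (Finset.univ.image e).erase (e k)) - energy P (e k) S)) := by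
        refine Finset.sum_le_sum fun k _ => mul_le_mul_of_nonneg_left ?_ (by positivity)
        -- Monotonicity of the energy replaces the chain before e k by the whole link of e k, which
        -- does not depend on the enumeration.
        have hsub : chainSet e S k ⊆ S ∪ (Finset.univ.image e).erase (e k) := by
          refine Finset.union_subset_union subset_rfl fun v hv => ?_
          obtain ⟨j, hj, rfl⟩ := Finset.mem_image.1 hv
          refine Finset.mem_erase.2 ⟨fun h => ?_, by simp⟩
          have := (Finset.mem_filter.1 hj).2
          rw [he h] at this
          exact lt_irrefl _ this
        have hnot : e k ∉ S ∪ (Finset.univ.image e).erase (e k) := by simp [heS k]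
        have h1 := energy_increment hP (S := S) (T := chainSet e S k)
          Finset.subset_union_left (fun h => hnot (hsub h)) hτ.le hτ1
        have h2 := energy_mono hP hsub hnot
        have h3 : 0 < τ ^ 2 / 24 := by positivity
        rw [show (24 : ℝ) / τ ^ 2 = (τ ^ 2 / 24)⁻¹ by rw [inv_div], ← div_eq_inv_mul,
          le_div_iff₀ h3]
        linarith
    _ = _ := by
        rw [Finset.mul_sum]
        exact Finset.sum_congr rfl fun k _ => by ring

end Increment

/-! ### A set that is stable under the addition of typical links. -/

section Pinning

variable {V : Type*} [Fintype V] [DecidableEq V]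

/-- The probability that a random subset of `V`, in which each point is put independently with
probability `q`, equals `R`. -/
def randomSubsetWeight (q : ℝ) (R : Finset V) : ℝ :=
  q ^ R.card * (1 - q) ^ (Finset.univ \ R).card

theorem randomSubsetWeight_nonneg {q : ℝ} (hq : 0 ≤ q) (hq1 : q ≤ 1) (R : Finset V) :
    0 ≤ randomSubsetWeight q R :=
  mul_nonneg (pow_nonneg hq _) (pow_nonneg (sub_nonneg.2 hq1) _)

theorem sum_randomSubsetWeight_superset (q : ℝ) (T : Finset V) :
    ∑ R : Finset V, randomSubsetWeight q R * (if T ⊆ R then 1 else 0) = q ^ T.card := by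
  -- Expanding this product over subsets R leaves exactly the weights of those R that contain T.
  have h := Finset.prod_add (fun _ : V => q) (fun v => if v ∈ T then 0 else 1 - q) Finset.univ
  have h1 : ∏ v : V, (q + if v ∈ T then 0 else 1 - q) = q ^ T.card := by
    have : ∀ v : V, (q + if v ∈ T then 0 else 1 - q) = if v ∈ T then q else 1 := fun v => by
      split_ifs <;> ring
    simp_rw [this]
    simp
  rw [← h1, h, Finset.powerset_univ]
  refine Finset.sum_congr rfl fun R _ => ?_
  rw [Finset.prod_const, randomSubsetWeight, mul_assoc]
  congr 1
  split_ifs with hT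
  · rw [mul_one, ← Finset.prod_const]
    refine Finset.prod_congr rfl fun v hv => ?_
    rw [if_neg fun h => (Finset.mem_sdiff.1 hv).2 (hT h)]
  · obtain ⟨v, hv, hv'⟩ := Finset.not_subset.1 hT
    rw [mul_zero, eq_comm]
    exact Finset.prod_eq_zero (i := v) (by simp [hv']) (by simp [hv])

theorem sum_randomSubsetWeight (q : ℝ) : ∑ R : Finset V, randomSubsetWeight q R = 1 := by
  simpa using sum_randomSubsetWeight_superset q (∅ : Finset V)

theorem sum_randomSubsetWeight_mul_deviation (q : ℝ) (L L' : Finset V) {s : ℕ}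
    (hL : L.card = s) (hL' : L'.card = s) :
    ∑ R : Finset V, randomSubsetWeight q R *
      (((if L ⊆ R then 1 else 0) - q ^ s) * ((if L' ⊆ R then 1 else 0) - q ^ s)) =
      q ^ (L ∪ L').card - q ^ s * q ^ s := by
  have : ∀ R : Finset V, randomSubsetWeight q R *
      (((if L ⊆ R then 1 else 0) - q ^ s) * ((if L' ⊆ R then 1 else 0) - q ^ s)) =
      randomSubsetWeight q R * (if L ∪ L' ⊆ R then 1 else 0) -
        q ^ s * (randomSubsetWeight q R * (if L ⊆ R then 1 else 0)) -
        q ^ s * (randomSubsetWeight q R * (if L' ⊆ R then 1 else 0)) +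
        q ^ s * q ^ s * randomSubsetWeight q R := by
    intro R
    have : ((if L ∪ L' ⊆ R then 1 else 0) : ℝ) =
        (if L ⊆ R then 1 else 0) * (if L' ⊆ R then 1 else 0) := by
      by_cases h : L ⊆ R <;> by_cases h' : L' ⊆ R <;> simp [Finset.union_subset_iff, h, h']
    rw [this]
    ring
  simp_rw [this, Finset.sum_add_distrib, Finset.sum_sub_distrib, ← Finset.mul_sum,
    sum_randomSubsetWeight_superset, sum_randomSubsetWeight, hL, hL']
  ring

variable {ι : Type*} (F : Finset ι) (v : ι → V) (L : ι → Finset V)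

/-- The number of pairs of links at a common vertex that are not disjoint. -/
def overlapCount : ℕ := by
  classical
  exact ((F ×ˢ F).filter fun p => v p.1 = v p.2 ∧ ¬ Disjoint (L p.1) (L p.2)).card

variable {F v L}

/-- Disjoint links lie in R independently, so their covariance vanishes; any other pair has
covariance at most 1. -/
theorem sum_variance_le {s : ℕ} (hL : ∀ f ∈ F, (L f).card = s) {q : ℝ} (hq : 0 ≤ q)
    (hq1 : q ≤ 1) :
    ∑ R : Finset V, randomSubsetWeight q R *
      ∑ i, (∑ f ∈ F with v f = i, (((if L f ⊆ R then 1 else 0) : ℝ) - q ^ s)) ^ 2 ≤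
      overlapCount F v L := by
  classical
  have h1 : ∀ R : Finset V,
      ∑ i, (∑ f ∈ F with v f = i, (((if L f ⊆ R then 1 else 0) : ℝ) - q ^ s)) ^ 2 =
      ∑ p ∈ F ×ˢ F with v p.1 = v p.2, (((if L p.1 ⊆ R then 1 else 0) : ℝ) - q ^ s) *
        ((if L p.2 ⊆ R then 1 else 0) - q ^ s) := by
    intro R
    rw [Finset.sum_filter, Finset.sum_product]
    simp_rw [sq, Finset.sum_mul_sum, Finset.sum_filter]
    rw [Finset.sum_comm]
    refine Finset.sum_congr rfl fun f _ => ?_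
    rw [Finset.sum_ite_eq]
    simp [eq_comm]
  simp_rw [h1, Finset.mul_sum]
  rw [Finset.sum_comm, overlapCount, Finset.card_filter, Nat.cast_sum, Finset.sum_filter]
  refine Finset.sum_le_sum fun p hp => ?_
  have hp' := Finset.mem_product.1 hp
  by_cases hv : v p.1 = v p.2
  · rw [if_pos hv, sum_randomSubsetWeight_mul_deviation q _ _ (hL _ hp'.1) (hL _ hp'.2)]
    by_cases hd : Disjoint (L p.1) (L p.2)
    · rw [Finset.card_union_of_disjoint hd, hL _ hp'.1, hL _ hp'.2, pow_add]
      simp [hd]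
    · have h2 : q ^ (L p.1 ∪ L p.2).card ≤ 1 := pow_le_one₀ hq hq1
      have h3 : 0 ≤ q ^ s * q ^ s := by positivity
      simp only [hv, hd, not_false_eq_true, and_self, if_true, Nat.cast_one]
      linarith
  · simp [hv]

theorem sum_abs_deviation_le {s : ℕ} (hL : ∀ f ∈ F, (L f).card = s) {q : ℝ} (hq : 0 ≤ q)
    (hq1 : q ≤ 1) {C : ℝ} (hC : 0 ≤ C)
    (hO : (Fintype.card V : ℝ) * overlapCount F v L ≤ C ^ 2) :
    ∑ R : Finset V, ∑ i, randomSubsetWeight q R *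
      |∑ f ∈ F with v f = i, (((if L f ⊆ R then 1 else 0) : ℝ) - q ^ s)| ≤ C := by
  set X : Finset V → V → ℝ := fun R i =>
    ∑ f ∈ F with v f = i, (((if L f ⊆ R then 1 else 0) : ℝ) - q ^ s) with hX
  have hw := randomSubsetWeight_nonneg (V := V) hq hq1
  refine abs_le_of_sq_le_sq' ?_ hC |>.2
  have hvar := sum_variance_le (v := v) hL hq hq1
  -- Cauchy–Schwarz over the pairs (R, i), whose total weight is |V|.
  have cs := Finset.sum_mul_sq_le_sq_mul_sq (Finset.univ ×ˢ Finset.univ : Finset (Finset V × V))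
    (fun p => √(randomSubsetWeight q p.1)) (fun p => √(randomSubsetWeight q p.1) * |X p.1 p.2|)
  simp only [← mul_assoc, mul_pow, Real.mul_self_sqrt (hw _), Real.sq_sqrt (hw _), sq_abs,
    Finset.sum_product] at cs
  refine cs.trans (le_trans ?_ hO)
  have e1 : ∑ R : Finset V, ∑ _i : V, randomSubsetWeight q R = Fintype.card V := by
    simp [← Finset.mul_sum, sum_randomSubsetWeight]
  rw [e1]
  simp_rw [Finset.mul_sum] at hvar
  exact mul_le_mul_of_nonneg_left hvar (Nat.cast_nonneg _)

/-- A set `S` that is cheap with respect to the subadditive cost `t`, and such that adding a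
typical link to `S` hardly changes the monotone functions `Φ`. -/
theorem exists_cheap_stable_set {s : ℕ} (hL : ∀ f ∈ F, (L f).card = s)
    {Φ : V → Finset V → ℝ} (hmono : ∀ i, Monotone (Φ i)) (h0 : ∀ i S, 0 ≤ Φ i S)
    (h1 : ∀ i S, Φ i S ≤ 1) {t : Finset V → ℝ} (ht0 : t ∅ = 0)
    (htU : ∀ S R, t (S ∪ R) ≤ t S + t R) {lam q C : ℝ} (hlam : 0 ≤ lam) (hq : 0 < q)
    (hq1 : q ≤ 1) {B : ℝ} (ht : ∑ R, randomSubsetWeight q R * t R ≤ B) (hC : 0 ≤ C)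
    (hO : (Fintype.card V : ℝ) * overlapCount F v L ≤ (C * q ^ s) ^ 2) :
    ∃ S, lam * t S ≤ F.card ∧
      ∑ f ∈ F, (Φ (v f) (S ∪ L f) - Φ (v f) S) ≤ lam * B + C := by
  have hw := randomSubsetWeight_nonneg (V := V) hq.le hq1
  have hqs : 0 < q ^ s := by positivity
  -- The maximiser of total Φ minus the penalised cost. Comparison with ∅ bounds its cost;
  -- comparison with S ∪ R bounds the gain from a random R.
  obtain ⟨S, -, hS⟩ := Finset.exists_max_image Finset.univ
    (fun S => ∑ f ∈ F, Φ (v f) S - lam * t S) Finset.univ_nonempty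
  have hF : ∀ S, ∑ f ∈ F, Φ (v f) S ≤ F.card := fun S => by
    simpa using Finset.sum_le_card_nsmul F (fun f => Φ (v f) S) 1 fun f _ => h1 _ _
  have hF0 : ∀ S, 0 ≤ ∑ f ∈ F, Φ (v f) S := fun S => Finset.sum_nonneg fun f _ => h0 _ _
  refine ⟨S, ?_, ?_⟩
  · have := hS ∅ (Finset.mem_univ _)
    rw [ht0, mul_zero, sub_zero] at this
    linarith [hF S, hF0 ∅]
  have hmax : ∑ R, randomSubsetWeight q R * ∑ f ∈ F, Φ (v f) (S ∪ R) ≤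
      ∑ f ∈ F, Φ (v f) S + lam * B := by
    calc ∑ R, randomSubsetWeight q R * ∑ f ∈ F, Φ (v f) (S ∪ R)
        ≤ ∑ R, randomSubsetWeight q R * (∑ f ∈ F, Φ (v f) S + lam * t R) := by
          refine Finset.sum_le_sum fun R _ => mul_le_mul_of_nonneg_left ?_ (hw R)
          have a1 := hS (S ∪ R) (Finset.mem_univ _)
          have a2 := mul_le_mul_of_nonneg_left (htU S R) hlam
          linarith
      _ = ∑ f ∈ F, Φ (v f) S + lam * ∑ R, randomSubsetWeight q R * t R := by
          simp_rw [mul_add, Finset.sum_add_distrib, ← Finset.sum_mul, sum_randomSubsetWeight,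
            one_mul, Finset.mul_sum]
          congr 1
          exact Finset.sum_congr rfl fun R _ => by ring
      _ ≤ _ := by gcongr
  have hdev := sum_abs_deviation_le (v := v) hL hq.le hq1 (mul_nonneg hC hqs.le) hO
  -- Each link lies in R with probability q^s, and then S ∪ R does at least as well as S ∪ L f. As Φ
  -- depends on f only through v f, the indicators may be summed over the links at each vertex,
  -- where they deviate little from q^s times the number of links.
  have hlink : q ^ s * ∑ f ∈ F, Φ (v f) (S ∪ L f) ≤
      q ^ s * ∑ R, randomSubsetWeight q R * ∑ f ∈ F, Φ (v f) (S ∪ R) + C * q ^ s := by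
    calc q ^ s * ∑ f ∈ F, Φ (v f) (S ∪ L f)
        = ∑ R, ∑ f ∈ F, randomSubsetWeight q R *
            ((if L f ⊆ R then 1 else 0) * Φ (v f) (S ∪ L f)) := by
          rw [Finset.sum_comm, Finset.mul_sum]
          refine Finset.sum_congr rfl fun f hf => ?_
          simp_rw [← mul_assoc, ← Finset.sum_mul, sum_randomSubsetWeight_superset, hL f hf]
      _ ≤ ∑ R, ∑ f ∈ F, randomSubsetWeight q R *
            ((if L f ⊆ R then 1 else 0) * Φ (v f) (S ∪ R)) := by
          refine Finset.sum_le_sum fun R _ => Finset.sum_le_sum fun f _ =>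
            mul_le_mul_of_nonneg_left ?_ (hw R)
          split_ifs with h
          · exact mul_le_mul_of_nonneg_left
              (hmono _ (Finset.union_subset_union subset_rfl h)) zero_le_one
          · simp
      _ = ∑ R, (q ^ s * (randomSubsetWeight q R * ∑ f ∈ F, Φ (v f) (S ∪ R)) +
            ∑ i, randomSubsetWeight q R * (Φ i (S ∪ R) *
              ∑ f ∈ F with v f = i, (((if L f ⊆ R then 1 else 0) : ℝ) - q ^ s))) := by
          refine Finset.sum_congr rfl fun R _ => ?_
          have : ∑ f ∈ F, Φ (v f) (S ∪ R) * (((if L f ⊆ R then 1 else 0) : ℝ) - q ^ s) =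
              ∑ i, Φ i (S ∪ R) *
                ∑ f ∈ F with v f = i, (((if L f ⊆ R then 1 else 0) : ℝ) - q ^ s) := by
            rw [← Finset.sum_fiberwise F v]
            refine Finset.sum_congr rfl fun i _ => ?_
            rw [Finset.mul_sum]
            exact Finset.sum_congr rfl fun f hf => by rw [(Finset.mem_filter.1 hf).2]
          rw [← Finset.mul_sum, ← Finset.mul_sum, ← this, Finset.mul_sum, mul_left_comm,
            ← mul_add, ← Finset.mul_sum, Finset.mul_sum, Finset.mul_sum, ← Finset.sum_add_distrib,
            Finset.mul_sum]
          exact Finset.sum_congr rfl fun f _ => by ring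
      _ ≤ ∑ R, (q ^ s * (randomSubsetWeight q R * ∑ f ∈ F, Φ (v f) (S ∪ R)) +
            ∑ i, randomSubsetWeight q R *
              |∑ f ∈ F with v f = i, (((if L f ⊆ R then 1 else 0) : ℝ) - q ^ s)|) := by
          refine Finset.sum_le_sum fun R _ => add_le_add le_rfl (Finset.sum_le_sum fun i _ =>
            mul_le_mul_of_nonneg_left ((le_abs_self _).trans ?_) (hw R))
          rw [abs_mul, abs_of_nonneg (h0 _ _)]
          exact mul_le_of_le_one_left (abs_nonneg _) (h1 _ _)
      _ ≤ _ := by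
          rw [Finset.sum_add_distrib, ← Finset.mul_sum]
          exact add_le_add le_rfl hdev
  have : ∑ f ∈ F, Φ (v f) (S ∪ L f) ≤
      ∑ R, randomSubsetWeight q R * ∑ f ∈ F, Φ (v f) (S ∪ R) + C := by
    refine le_of_mul_le_mul_left ?_ hqs
    linarith
  rw [Finset.sum_sub_distrib]
  linarith

end Pinning

/-! ### Restriction along embeddings and projections of boxes. -/

theorem measurePreserving_comp_embedding {W V : Type u} [Fintype W] [Fintype V] (φ : W ↪ V) :
    MeasurePreserving (fun (x : Decoration V) (k : W) => x (φ k)) volume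
      (volume : Measure (Decoration W)) := by
  have hm : Measurable (fun (x : Decoration V) (k : W) => x (φ k)) := by fun_prop
  refine ⟨hm, ?_⟩
  refine (Measure.pi_eq fun s hs => ?_).symm
  rw [Measure.map_apply hm (MeasurableSet.univ_pi hs)]
  have : (fun (x : Decoration V) (k : W) => x (φ k)) ⁻¹' Set.univ.pi s =
      Set.univ.pi (Function.extend φ s fun _ => Set.univ) := by
    ext x
    simp only [Set.mem_preimage, Set.mem_univ_pi]
    constructor
    · intro h i
      by_cases hi : ∃ k, φ k = i
      · obtain ⟨k, rfl⟩ := hi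
        rw [φ.injective.extend_apply]
        exact h k
      · rw [Function.extend_apply' _ _ _ hi]
        trivial
    · intro h k
      simpa [φ.injective.extend_apply] using h (φ k)
  rw [this, volume_pi_pi]
  refine (Fintype.prod_of_injective φ φ.injective _ _ (fun i hi => ?_) fun k => ?_).symm
  · rw [Function.extend_apply' _ _ _ hi, measure_univ]
  · rw [φ.injective.extend_apply]

theorem projection_box_subset {W V : Type u} [Fintype V] (φ : W ↪ V)
    (A : V → Set unitInterval) :
    projection φ {c : Decoration V | ∀ i, c i ∈ A i} ⊆ {c | ∀ k, c k ∈ A (φ k)} := by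
  intro c hc k
  have hc' : (0 : ENNReal) < _ := hc
  obtain ⟨-, ⟨x, ⟨hx, hxc⟩, -⟩⟩ := nonempty_of_measure_ne_zero hc'.ne'
  rw [← hxc k]
  exact hx (φ k)

/-! ### Boxes with exceptional coordinates, and boxes of likely values. -/

section Boxes

variable {V : Type u} [Fintype V]

/-- A product set of volume at most `∏ α i` does not become much larger when few exceptional
coordinates are allowed. -/
theorem volume_fewExceptions_le {A : V → Set unitInterval} (hA : ∀ i, MeasurableSet (A i))
    {α : V → ℝ} (hα : ∀ i, 0 < α i) (hAα : ∀ i, volume.real (A i) ≤ α i) {τ κ : ℝ} (hτ : 0 < τ)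
    (hτ1 : τ < 1) :
    volume.real {x : Decoration V |
      ∑ i, (A i)ᶜ.indicator (fun _ => -Real.log τ - Real.log (α i)) (x i) ≤
      κ * ∑ i, (-Real.log τ - Real.log (α i))} ≤
      Real.exp (∑ i, (Real.log (α i) - Real.log (1 - τ) + κ * (-Real.log τ - Real.log (α i)))) := by
  set w : V → ℝ := fun i => -Real.log τ - Real.log (α i) with hw
  -- A mixture, of integral at most 1, of a density on A i and, with weight τ, the uniform one. A
  -- regular coordinate contributes at least (1-τ)/α i and an exception contributes τ, so an
  -- exception costs at most a factor exp(-w i). Markov's inequality for the product of the q i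
  -- concludes.
  set q : V → unitInterval → ℝ := fun i y => (A i).indicator (fun _ => (1 - τ) / α i) y + τ with hq
  have hqm : ∀ i, Measurable (q i) := fun i => (measurable_const.indicator (hA i)).add_const τ
  have hq0 : ∀ i y, 0 ≤ q i y := fun i y => by
    have : 0 ≤ (1 - τ) / α i := div_nonneg (by linarith) (hα i).le
    exact add_nonneg (Set.indicator_nonneg (fun _ _ => this) y) hτ.le
  have hqint : ∫ x : Decoration V, ∏ i, q i (x i) ≤ 1 := by
    rw [integral_fintype_prod_volume_eq_prod (fun i => q i)]
    refine Finset.prod_le_one (fun i _ => integral_nonneg (hq0 i)) fun i _ => ?_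
    have : ∫ y, q i y = volume.real (A i) * ((1 - τ) / α i) + τ := by
      rw [hq, integral_add ((integrable_const _).indicator (hA i)) (integrable_const _),
        integral_indicator_const _ (hA i)]
      simp
    rw [this]
    have h1 : volume.real (A i) * ((1 - τ) / α i) ≤ 1 - τ := by
      rw [mul_div_assoc', div_le_iff₀ (hα i), mul_comm]
      exact mul_le_mul_of_nonneg_left (hAα i) (by linarith)
    linarith
  set c : ℝ := Real.exp (-∑ i, (Real.log (α i) - Real.log (1 - τ) + κ * w i)) with hc
  have hle : ∀ x : Decoration V, ∑ i, (A i)ᶜ.indicator (fun _ => w i) (x i) ≤ κ * ∑ i, w i →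
      c ≤ ∏ i, q i (x i) := by
    intro x hx
    have h1 : ∀ i, Real.exp (-(Real.log (α i) - Real.log (1 - τ)) -
        (A i)ᶜ.indicator (fun _ => w i) (x i)) ≤ q i (x i) := by
      intro i
      by_cases hi : x i ∈ A i
      · rw [Set.indicator_of_notMem (by simpa using hi), hq]
        simp only [Set.indicator_of_mem hi, sub_zero, neg_sub]
        rw [Real.exp_sub, Real.exp_log (by linarith), Real.exp_log (hα i)]
        linarith
      · rw [Set.indicator_of_mem (by simpa using hi), hq]
        simp only [Set.indicator_of_notMem hi, zero_add, hw]
        have : Real.log (1 - τ) ≤ 0 := Real.log_nonpos (by linarith) (by linarith)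
        calc Real.exp _ ≤ Real.exp (Real.log τ) := Real.exp_le_exp.2 (by linarith)
          _ = τ := Real.exp_log hτ
    refine le_trans ?_ (Finset.prod_le_prod (fun i _ => (Real.exp_pos _).le) fun i _ => h1 i)
    rw [← Real.exp_sum, hc]
    refine Real.exp_le_exp.2 ?_
    rw [Finset.sum_sub_distrib, Finset.sum_neg_distrib, Finset.sum_add_distrib, ← Finset.mul_sum]
    linarith
  have hqi : Integrable (fun x : Decoration V => ∏ i, q i (x i)) volume := by
    refine integrable_of_measurable_of_abs_le (C := ∏ i, ((1 - τ) / α i + τ)) ?_ fun x => ?_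
    · exact Finset.measurable_fun_prod _ fun i _ => (hqm i).comp (measurable_pi_apply i)
    · rw [abs_of_nonneg (Finset.prod_nonneg fun i _ => hq0 i _)]
      refine Finset.prod_le_prod (fun i _ => hq0 i _) fun i _ => ?_
      have : 0 ≤ (1 - τ) / α i := div_nonneg (by linarith) (hα i).le
      exact add_le_add (Set.indicator_le' (fun _ _ => le_rfl) (fun _ _ => this) _) le_rfl
  have hmk := mul_meas_ge_le_integral_of_nonneg
    (Eventually.of_forall fun x : Decoration V => Finset.prod_nonneg fun i _ => hq0 i (x i)) hqi c
  have hcpos : 0 < c := Real.exp_pos _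
  have hsub : volume.real {x : Decoration V | ∑ i, (A i)ᶜ.indicator (fun _ => w i) (x i) ≤
      κ * ∑ i, w i} ≤ volume.real {x : Decoration V | c ≤ ∏ i, q i (x i)} :=
    measureReal_mono (fun x hx => hle x hx)
  refine hsub.trans ?_
  have h2 : c * volume.real {x : Decoration V | c ≤ ∏ i, q i (x i)} ≤ 1 := hmk.trans hqint
  rw [← le_div_iff₀' hcpos, hc, one_div, ← Real.exp_neg, neg_neg] at h2
  exact h2

variable [DecidableEq V] {P : Set (Decoration V)} {S : Finset V}

/-- The values of the coordinate `i` that have conditional density above `τ` given the values of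
`z` on `S`. -/
def likelyValues (P : Set (Decoration V)) (S : Finset V) (τ : ℝ) (z : Decoration V) (i : V) :
    Set unitInterval :=
  {y | i ∈ S ∨ τ * marginalDensity P S z < marginalDensity P (insert i S) (Function.update z i y)}

theorem mem_likelyValues_self {τ : ℝ} {z : Decoration V} {i : V} :
    z i ∈ likelyValues P S τ z i ↔
      i ∈ S ∨ τ * marginalDensity P S z < marginalDensity P (insert i S) z := by
  simp [likelyValues]

theorem likelyValues_congr {τ : ℝ} {z z' : Decoration V} (h : ∀ j ∈ S, z j = z' j) (i : V) :
    likelyValues P S τ z i = likelyValues P S τ z' i := by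
  have h1 : ∀ y, marginalDensity P (insert i S) (Function.update z i y) =
      marginalDensity P (insert i S) (Function.update z' i y) := fun y =>
    marginalDensity_congr fun j hj => by
      by_cases hji : j = i
      · simp [hji]
      · simp [hji, h j (Finset.mem_of_mem_insert_of_ne hj hji)]
  simp only [likelyValues, h1, marginalDensity_congr h]

theorem measurableSet_likelyValues_prod (hP : MeasurableSet P) (S : Finset V) (τ : ℝ) (i : V) :
    MeasurableSet {p : Decoration V × unitInterval | p.2 ∈ likelyValues P S τ p.1 i} := by
  have h := measurable_marginalDensity hP
  have : {p : Decoration V × unitInterval | p.2 ∈ likelyValues P S τ p.1 i} =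
      {_p | i ∈ S} ∪ {p | τ * marginalDensity P S p.1 <
        marginalDensity P (insert i S) (Function.update p.1 i p.2)} := by
    ext p
    simp [likelyValues]
  rw [this]
  refine (MeasurableSet.const _).union (measurableSet_lt ?_ ?_)
  · exact ((h S).comp measurable_fst).const_mul τ
  · exact (h _).comp measurable_update'

theorem measurableSet_likelyValues (hP : MeasurableSet P) (S : Finset V) (τ : ℝ) (z : Decoration V)
    (i : V) : MeasurableSet (likelyValues P S τ z i) :=
  measurable_prodMk_left (x := z) (measurableSet_likelyValues_prod hP S τ i)

theorem measurable_volume_likelyValues (hP : MeasurableSet P) (S : Finset V) (τ : ℝ) (i : V) :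
    Measurable fun z => volume.real (likelyValues P S τ z i) :=
  (measurable_measure_prodMk_left (measurableSet_likelyValues_prod hP S τ i)).ennreal_toReal

theorem measurableSet_mem_likelyValues_self (hP : MeasurableSet P) (S : Finset V) (τ : ℝ) (i : V) :
    MeasurableSet {z : Decoration V | z i ∈ likelyValues P S τ z i} :=
  (measurable_id.prodMk (measurable_pi_apply i)) (measurableSet_likelyValues_prod hP S τ i)

/-- On unlikely values the conditional density of the coordinate i is at most τ, and these values
have Lebesgue measure at most 1. The weight h may vary with the values on S, as the weights of
exceptions do. -/
theorem integral_unlikely_le (hP : MeasurableSet P) {τ : ℝ} (hτ : 0 ≤ τ) (i : V)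
    {h : Decoration V → ℝ} (hm : Measurable h) (h0 : ∀ x, 0 ≤ h x) (h1 : ∀ x, h x ≤ 1)
    (hind : ∀ x y, (∀ j ∈ S, x j = y j) → h x = h y) :
    ∫ z, {z | z i ∈ likelyValues P S τ z i}ᶜ.indicator h z * marginalDensity P Finset.univ z ≤
      τ * ∫ z, h z * marginalDensity P Finset.univ z := by
  set B : Set (Decoration V) := {z | z i ∈ likelyValues P S τ z i}ᶜ with hB
  have hBm : MeasurableSet B := (measurableSet_mem_likelyValues_self hP S τ i).compl
  have habs : ∀ x, |h x| ≤ 1 := fun x => by rw [abs_of_nonneg (h0 x)]; exact h1 x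
  have hBabs : ∀ x, |B.indicator h x| ≤ 1 := fun x => by
    by_cases hx : x ∈ B <;> simp [hx, habs x]
  have e1 : ∫ z, B.indicator h z * marginalDensity P Finset.univ z =
      ∫ z, B.indicator h z * marginalDensity P (insert i S) z := by
    refine integral_mul_marginalDensity hP (Finset.subset_univ _) (hm.indicator hBm) hBabs
      fun x y hxy => ?_
    have hxy' : ∀ j ∈ insert i S, x j = y j := fun j hj =>
      hxy j fun h => (Finset.mem_sdiff.1 h).2 hj
    have hS : ∀ j ∈ S, x j = y j := fun j hj => hxy' j (Finset.mem_insert_of_mem hj)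
    have : x ∈ B ↔ y ∈ B := by
      simp only [hB, Set.mem_compl_iff, Set.mem_ofPred_eq, likelyValues_congr hS,
        hxy' i (Finset.mem_insert_self i S)]
    by_cases hx : x ∈ B
    · rw [Set.indicator_of_mem hx, Set.indicator_of_mem (this.1 hx), hind x y hS]
    · rw [Set.indicator_of_notMem hx, Set.indicator_of_notMem fun hy => hx (this.2 hy)]
  have e2 : ∫ z, h z * marginalDensity P Finset.univ z = ∫ z, h z * marginalDensity P S z :=
    integral_mul_marginalDensity hP (Finset.subset_univ _) hm habs fun x y hxy =>
      hind x y fun j hj => hxy j (by simpa using hj)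
  have int : ∀ {f : Decoration V → ℝ} (T : Finset V), Measurable f → (∀ x, |f x| ≤ 1) →
      Integrable (fun x => f x * marginalDensity P T x) volume := fun T fm f1 =>
    integrable_of_measurable_of_abs_le (fm.mul (measurable_marginalDensity hP T)) (C := 1)
      fun x => by
        rw [abs_mul, abs_of_nonneg (marginalDensity_nonneg x)]
        exact mul_le_one₀ (f1 x) (marginalDensity_nonneg x) (marginalDensity_le_one x)
  rw [e1, e2, ← integral_const_mul]
  refine integral_mono (int _ (hm.indicator hBm) hBabs) ((int _ hm habs).const_mul _) fun z => ?_
  simp only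
  by_cases hz : z ∈ B
  · rw [Set.indicator_of_mem hz]
    have hlow := (not_or.1 fun hh => hz (mem_likelyValues_self.2 hh)).2
    nlinarith [mul_le_mul_of_nonneg_left (not_lt.1 hlow) (h0 z)]
  · rw [Set.indicator_of_notMem hz, zero_mul]
    exact mul_nonneg hτ (mul_nonneg (h0 z) (marginalDensity_nonneg z))

end Boxes

/-! ### The excess of the box of likely values along one embedding. -/

section Excess

variable {V W : Type u} [Fintype V] [DecidableEq V] {P : Set (Decoration V)}
  {S : Finset V}

/-- The volume of the points of the box of likely values whose restriction along `φ` lies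
outside `Q`. -/
noncomputable def likelyExcess (P : Set (Decoration V)) (S : Finset V) (τ : ℝ)
    (Q : Set (Decoration W)) (φ : W ↪ V) (z : Decoration V) : ℝ :=
  volume.real {x : Decoration V |
    (∀ k, x (φ k) ∈ likelyValues P S τ z (φ k)) ∧ (fun k => x (φ k)) ∉ Q}

theorem likelyExcess_nonneg {τ : ℝ} {Q : Set (Decoration W)} {φ : W ↪ V} (z : Decoration V) :
    0 ≤ likelyExcess P S τ Q φ z :=
  measureReal_nonneg

theorem likelyExcess_le_one {τ : ℝ} {Q : Set (Decoration W)} {φ : W ↪ V} (z : Decoration V) :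
    likelyExcess P S τ Q φ z ≤ 1 :=
  measureReal_le_one

theorem likelyExcess_congr {τ : ℝ} {Q : Set (Decoration W)} {φ : W ↪ V} {z z' : Decoration V}
    (h : ∀ j ∈ S, z j = z' j) : likelyExcess P S τ Q φ z = likelyExcess P S τ Q φ z' := by
  simp only [likelyExcess, likelyValues_congr h]

variable [Fintype W]

theorem measurableSet_likelyExcess_prod (hP : MeasurableSet P) (S : Finset V) (τ : ℝ)
    {Q : Set (Decoration W)} (hQ : MeasurableSet Q) (φ : W ↪ V) :
    MeasurableSet {p : Decoration V × Decoration V |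
      (∀ k, p.2 (φ k) ∈ likelyValues P S τ p.1 (φ k)) ∧ (fun k => p.2 (φ k)) ∉ Q} := by
  have : {p : Decoration V × Decoration V |
      (∀ k, p.2 (φ k) ∈ likelyValues P S τ p.1 (φ k)) ∧ (fun k => p.2 (φ k)) ∉ Q} =
      (⋂ k, (fun p : Decoration V × Decoration V => (p.1, p.2 (φ k))) ⁻¹'
        {p | p.2 ∈ likelyValues P S τ p.1 (φ k)}) ∩
      (fun p : Decoration V × Decoration V => fun k => p.2 (φ k)) ⁻¹' Qᶜ := by
    ext p
    simp
  rw [this]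
  refine (MeasurableSet.iInter fun k => ?_).inter ?_
  · exact (by fun_prop : Measurable fun p : Decoration V × Decoration V => (p.1, p.2 (φ k)))
      (measurableSet_likelyValues_prod hP S τ (φ k))
  · exact (by fun_prop : Measurable
      fun p : Decoration V × Decoration V => fun k => p.2 (φ k)) hQ.compl

theorem measurable_likelyExcess (hP : MeasurableSet P) (S : Finset V) (τ : ℝ)
    {Q : Set (Decoration W)} (hQ : MeasurableSet Q) (φ : W ↪ V) :
    Measurable (likelyExcess P S τ Q φ) :=
  (measurable_measure_prodMk_left
    (measurableSet_likelyExcess_prod hP S τ hQ φ)).ennreal_toReal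

theorem integral_likelyExcess_mul (hP : MeasurableSet P) {τ : ℝ} {Q : Set (Decoration W)}
    (hQ : MeasurableSet Q) {φ : W ↪ V} :
    ∫ z, likelyExcess P S τ Q φ z * marginalDensity P Finset.univ z =
      ∫ z, likelyExcess P S τ Q φ z * marginalDensity P S z := by
  refine integral_mul_marginalDensity hP (Finset.subset_univ _)
    (measurable_likelyExcess hP S τ hQ φ) (C := 1) (fun z => ?_) fun x y hxy =>
      likelyExcess_congr fun j hj => hxy j (by simpa using hj)
  rw [abs_of_nonneg (likelyExcess_nonneg z)]
  exact likelyExcess_le_one z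

theorem integral_likelyExcess_le_volume (hP : MeasurableSet P) {τ : ℝ} {Q : Set (Decoration W)}
    (hQ : MeasurableSet Q) {φ : W ↪ V} :
    ∫ z, likelyExcess P S τ Q φ z * marginalDensity P S z ≤ volume.real P := by
  rw [← integral_marginalDensity hP S]
  refine integral_mono (integrable_of_measurable_of_abs_le (C := 1)
    ((measurable_likelyExcess hP S τ hQ φ).mul (measurable_marginalDensity hP S)) fun z => ?_)
    (integrable_marginalDensity hP S) fun z =>
      mul_le_of_le_one_left (marginalDensity_nonneg z) (likelyExcess_le_one z)
  rw [abs_of_nonneg (mul_nonneg (likelyExcess_nonneg z) (marginalDensity_nonneg z))]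
  exact mul_le_one₀ (likelyExcess_le_one z) (marginalDensity_nonneg z) (marginalDensity_le_one z)

/-- Taking z on S and an independent x off S gives a single uniform decoration. This turns the
integral into that of `integral_likelySet_le` for the decorations whose restriction leaves Q; by
`hφ`, no point of P has such a restriction. -/
theorem integral_likelyExcess_le (hP : MeasurableSet P) {Q : Set (Decoration W)}
    (hQ : MeasurableSet Q) {φ : W ↪ V} (hφ : ∀ x ∈ P, (fun k => x (φ k)) ∈ Q)
    (hS : ∀ k, φ k ∉ S) {τ : ℝ} (hτ : 0 < τ) (hτ1 : τ ≤ 1) :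
    ∫ z, likelyExcess P S τ Q φ z * marginalDensity P S z ≤
      (2 / τ) ^ Fintype.card W * (24 / τ ^ 2) *
        ∑ k, (energy P (φ k) (S ∪ (Finset.univ.image φ).erase (φ k)) - energy P (φ k) S) := by
  set e : Fin (Fintype.card W) → V := fun j => φ ((Fintype.equivFin W).symm j) with he
  set F : Set (Decoration V) := {x | (fun k => x (φ k)) ∉ Q} with hF
  have hFm : MeasurableSet F :=
    (by fun_prop : Measurable fun (x : Decoration V) k => x (φ k)) hQ.compl
  have hrange : Finset.univ.image e = Finset.univ.image φ := by
    ext v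
    simp only [he, Finset.mem_image, Finset.mem_univ, true_and]
    exact (Fintype.equivFin W).symm.exists_congr_left.trans (by simp)
  have main := integral_likelySet_le hP (e := e)
    (φ.injective.comp (Fintype.equivFin W).symm.injective) (fun k => hS _) hFm
    (fun x hx z hz hzP => hx (by
      have : (fun k => x (φ k)) = fun k => z (φ k) := by
        funext k
        simpa [he] using (hz (Fintype.equivFin W k)).symm
      rw [this]
      exact hφ z hzP)) hτ hτ1
  rw [hrange] at main
  have hsum : ∑ k, (energy P (e k) (S ∪ (Finset.univ.image φ).erase (e k)) - energy P (e k) S) =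
      ∑ k, (energy P (φ k) (S ∪ (Finset.univ.image φ).erase (φ k)) - energy P (φ k) S) :=
    Equiv.sum_comp (Fintype.equivFin W).symm
      fun k => energy P (φ k) (S ∪ (Finset.univ.image φ).erase (φ k)) - energy P (φ k) S
  rw [hsum] at main
  refine le_trans (le_of_eq ?_) main
  have hLm := measurableSet_likelySet hP S e τ hFm
  have hGm := (measurable_marginalDensity hP S).indicator hLm
  rw [← (measurePreserving_finset_piecewise S).integral_comp_of_measurable hGm, integral_prod]
  · refine integral_congr_ae (Eventually.of_forall fun z => ?_)
    simp only
    have hm : MeasurableSet {x : Decoration V |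
        (∀ k, x (φ k) ∈ likelyValues P S τ z (φ k)) ∧ (fun k => x (φ k)) ∉ Q} :=
      measurable_prodMk_left (x := z) (measurableSet_likelyExcess_prod hP S τ hQ φ)
    rw [likelyExcess, ← smul_eq_mul, ← integral_indicator_const _ hm]
    refine integral_congr_ae (Eventually.of_forall fun x => ?_)
    simp only
    have hz : marginalDensity P S (S.piecewise z x) = marginalDensity P S z :=
      marginalDensity_congr fun j hj => Finset.piecewise_eq_of_mem _ _ _ hj
    have hk : ∀ k, S.piecewise z x (φ k) = x (φ k) := fun k =>
      Finset.piecewise_eq_of_notMem _ _ _ (hS k)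
    have hins : ∀ k, marginalDensity P (insert (φ k) S) (S.piecewise z x) =
        marginalDensity P (insert (φ k) S) (Function.update z (φ k) (x (φ k))) := fun k =>
      marginalDensity_congr fun j hj => by
        rcases Finset.mem_insert.1 hj with rfl | hj
        · simp [hk]
        · rw [Finset.piecewise_eq_of_mem _ _ _ hj, Function.update_of_ne]
          exact fun h => hS k (h ▸ hj)
    have hiff : x ∈ {x : Decoration V |
        (∀ k, x (φ k) ∈ likelyValues P S τ z (φ k)) ∧ (fun k => x (φ k)) ∉ Q} ↔
        S.piecewise z x ∈ likelySet P S e τ F := by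
      have h1 : S.piecewise z x ∈ F ↔ (fun k => x (φ k)) ∉ Q := by
        simp only [hF, Set.mem_ofPred_eq, hk]
      have h2 : S.piecewise z x ∈ likelySet P S e τ F ↔ S.piecewise z x ∈ F ∧
          ∀ k : W, τ * marginalDensity P S z <
            marginalDensity P (insert (φ k) S) (S.piecewise z x) := by
        simp only [likelySet, Set.mem_ofPred_eq, hz]
        exact and_congr_right fun _ => (Fintype.equivFin W).symm.forall_congr_left.trans
          (by simp [he])
      rw [h2, h1, and_comm]
      simp [likelyValues, hS, hins]
    by_cases hx : x ∈ {x : Decoration V |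
        (∀ k, x (φ k) ∈ likelyValues P S τ z (φ k)) ∧ (fun k => x (φ k)) ∉ Q}
    · rw [Set.indicator_of_mem hx, Set.indicator_of_mem (hiff.1 hx), hz]
    · rw [Set.indicator_of_notMem hx, Set.indicator_of_notMem fun h => hx (hiff.2 h)]
  · refine integrable_of_measurable_of_abs_le
      (hGm.comp (measurable_finset_piecewise S)) (C := 1) fun p => ?_
    rw [abs_of_nonneg (Set.indicator_nonneg (fun _ _ => marginalDensity_nonneg _) _)]
    exact Set.indicator_le' (fun _ _ => marginalDensity_le_one _) (fun _ _ => zero_le_one) _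

end Excess

/-! ### From small boxes to small volume. -/

section Saturation

variable {V W : Type u} [Fintype V] [Fintype W]

/-- The projection of a box lies in the product of its sides along φ, and restriction along φ
preserves measure. The excess measured in the large cube therefore dominates the one in `hbox`. -/
theorem volume_box_le {A : V → Set unitInterval} {Q : Set (Decoration W)}
    {E : Finset (W ↪ V)} {η β : ℝ}
    (hbox : ∀ b : Set (Decoration V), IsBox b →
      (∑ φ ∈ E, (volume (projection φ b \ Q)).toReal) / (E.card : ℝ) < η → volume.real b ≤ β)
    (hQ : MeasurableSet Q) (hA : ∀ i, MeasurableSet (A i))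
    (hex : (∑ φ ∈ E, volume.real {x : Decoration V |
      (∀ k, x (φ k) ∈ A (φ k)) ∧ (fun k => x (φ k)) ∉ Q}) / (E.card : ℝ) < η) :
    ∏ i, volume.real (A i) ≤ β := by
  have hb : {c : Decoration V | ∀ i, c i ∈ A i} = Set.univ.pi A := by
    ext x
    simp
  have hv : volume.real {c : Decoration V | ∀ i, c i ∈ A i} = ∏ i, volume.real (A i) := by
    rw [hb, Measure.real, volume_pi_pi, ENNReal.toReal_prod]
    rfl
  rw [← hv]
  refine hbox _ ⟨A, hA, rfl⟩ (lt_of_le_of_lt ?_ hex)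
  gcongr with φ _
  have hm : MeasurableSet {c : Decoration W | (∀ k, c k ∈ A (φ k)) ∧ c ∉ Q} := by
    have : {c : Decoration W | (∀ k, c k ∈ A (φ k)) ∧ c ∉ Q} =
        (Set.univ.pi fun k => A (φ k)) ∩ Qᶜ := by
      ext c
      simp
    rw [this]
    exact (MeasurableSet.univ_pi fun k => hA _).inter hQ.compl
  have hpre := (measurePreserving_comp_embedding φ).measureReal_preimage hm.nullMeasurableSet
  have hle : volume.real (projection φ {c : Decoration V | ∀ i, c i ∈ A i} \ Q) ≤
      volume.real {c : Decoration W | (∀ k, c k ∈ A (φ k)) ∧ c ∉ Q} :=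
    measureReal_mono fun c hc => ⟨projection_box_subset φ A hc.1, hc.2⟩
  exact hle.trans hpre.ge

variable [DecidableEq V] {P : Set (Decoration V)} {S : Finset V}

/-- Embeddings that meet S contribute at most vol P each; the others are controlled by energy.
Erasing φ k keeps the energies monotone for every S, and changes nothing when φ misses S. -/
theorem sum_integral_likelyExcess_le (hP : MeasurableSet P) {Q : Set (Decoration W)}
    (hQ : MeasurableSet Q) {E : Finset (W ↪ V)}
    (hE : ∀ φ ∈ E, ∀ x ∈ P, (fun k => x (φ k)) ∈ Q) {τ δ δ' : ℝ} (hτ : 0 < τ) (hτ1 : τ ≤ 1)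
    (htouch : ((E.filter fun φ => ∃ k, φ k ∈ S).card : ℝ) ≤ δ * E.card)
    (hstab : ∑ φ ∈ E, ∑ k, (energy P (φ k) ((S ∪ (Finset.univ.image φ).erase (φ k)).erase (φ k)) -
      energy P (φ k) (S.erase (φ k))) ≤ δ' * E.card * volume.real P) :
    ∑ φ ∈ E, ∫ z, likelyExcess P S τ Q φ z * marginalDensity P S z ≤
      (δ + (2 / τ) ^ Fintype.card W * (24 / τ ^ 2) * δ') * E.card * volume.real P := by
  set K := (2 / τ) ^ Fintype.card W * (24 / τ ^ 2) with hK
  have hK0 : 0 ≤ K := by positivity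
  have hv : 0 ≤ volume.real P := measureReal_nonneg
  have hd : ∀ φ : W ↪ V, 0 ≤
      ∑ k, (energy P (φ k) ((S ∪ (Finset.univ.image φ).erase (φ k)).erase (φ k)) -
        energy P (φ k) (S.erase (φ k))) := fun φ => Finset.sum_nonneg fun k _ =>
    sub_nonneg.2 (energy_mono hP (Finset.erase_subset_erase _ Finset.subset_union_left)
      (Finset.notMem_erase _ _))
  have hφ : ∀ φ ∈ E, ∫ z, likelyExcess P S τ Q φ z * marginalDensity P S z ≤
      (if ∃ k, φ k ∈ S then 1 else 0) * volume.real P +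
      K * ∑ k, (energy P (φ k) ((S ∪ (Finset.univ.image φ).erase (φ k)).erase (φ k)) -
        energy P (φ k) (S.erase (φ k))) := by
    intro φ hφE
    split_ifs with h
    · rw [one_mul]
      exact (integral_likelyExcess_le_volume hP hQ).trans
        (le_add_of_nonneg_right (mul_nonneg hK0 (hd φ)))
    · push Not at h
      rw [zero_mul, zero_add]
      convert integral_likelyExcess_le hP hQ (hE φ hφE) h hτ hτ1 using 7 with k
      · exact Finset.erase_eq_of_notMem (by simp [h k])
      · exact Finset.erase_eq_of_notMem (h _)
  calc _ ≤ _ := Finset.sum_le_sum hφ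
    _ = ((E.filter fun φ => ∃ k, φ k ∈ S).card : ℝ) * volume.real P + K * ∑ φ ∈ E,
        ∑ k, (energy P (φ k) ((S ∪ (Finset.univ.image φ).erase (φ k)).erase (φ k)) -
        energy P (φ k) (S.erase (φ k))) := by
      rw [Finset.sum_add_distrib, ← Finset.sum_mul, ← Finset.mul_sum, Finset.sum_boole]
    _ ≤ δ * E.card * volume.real P + K * (δ' * E.card * volume.real P) := by gcongr
    _ = _ := by ring

/-- A substitute for the volume of the likely values that does not vanish. -/
noncomputable def likelyVolume (P : Set (Decoration V)) (S : Finset V) (τ β : ℝ)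
    (z : Decoration V) (i : V) : ℝ :=
  if volume.real (likelyValues P S τ z i) = 0 then β else volume.real (likelyValues P S τ z i)

variable {τ β : ℝ}

theorem likelyVolume_pos (hβ : 0 < β) (z : Decoration V) (i : V) :
    0 < likelyVolume P S τ β z i := by
  unfold likelyVolume
  split_ifs with h
  · exact hβ
  · exact lt_of_le_of_ne measureReal_nonneg (Ne.symm h)

theorem likelyVolume_le_one (hβ : β ≤ 1) (z : Decoration V) (i : V) :
    likelyVolume P S τ β z i ≤ 1 := by
  unfold likelyVolume
  split_ifs with h
  · exact hβ
  · exact measureReal_le_one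

theorem volume_likelyValues_le_likelyVolume (hβ : 0 < β) (z : Decoration V) (i : V) :
    volume.real (likelyValues P S τ z i) ≤ likelyVolume P S τ β z i := by
  unfold likelyVolume
  split_ifs with h
  · rw [h]
    exact hβ.le
  · exact le_rfl

theorem likelyVolume_congr {z z' : Decoration V} (h : ∀ j ∈ S, z j = z' j) (i : V) :
    likelyVolume P S τ β z i = likelyVolume P S τ β z' i := by
  simp only [likelyVolume, likelyValues_congr h]

theorem measurable_likelyVolume (hP : MeasurableSet P) (S : Finset V) (τ β : ℝ) (i : V) :
    Measurable fun z => likelyVolume P S τ β z i := by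
  have h := measurable_volume_likelyValues hP S τ i
  exact Measurable.ite (h (measurableSet_singleton 0)) measurable_const h

/-- If some set of likely values is null, its substitute β alone brings the product down to β, all
other factors being at most 1. So logarithms can be taken without losing the bound. -/
theorem prod_likelyVolume_le (hβ : 0 < β) (hβ1 : β ≤ 1) {z : Decoration V}
    (h : ∏ i, volume.real (likelyValues P S τ z i) ≤ β) :
    ∏ i, likelyVolume P S τ β z i ≤ β := by
  by_cases h0 : ∃ i, volume.real (likelyValues P S τ z i) = 0
  · obtain ⟨i, hi⟩ := h0
    rw [← Finset.mul_prod_erase Finset.univ _ (Finset.mem_univ i)]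
    have h1 : likelyVolume P S τ β z i = β := if_pos hi
    rw [h1]
    exact mul_le_of_le_one_right hβ.le (Finset.prod_le_one
      (fun j _ => (likelyVolume_pos hβ z j).le) fun j _ => likelyVolume_le_one hβ1 z j)
  · push Not at h0
    have : ∀ i, likelyVolume P S τ β z i = volume.real (likelyValues P S τ z i) :=
      fun i => if_neg (h0 i)
    simpa only [this] using h

/-- The total weight of the coordinates of `z` that are unlikely given the values on `S`. -/
noncomputable def unlikelyWeight (P : Set (Decoration V)) (S : Finset V) (τ β : ℝ)
    (z : Decoration V) : ℝ :=
  ∑ i, (likelyValues P S τ z i)ᶜ.indicator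
    (fun _ => -Real.log τ - Real.log (likelyVolume P S τ β z i)) (z i)

/-- The total weight of all coordinates. -/
noncomputable def totalWeight (P : Set (Decoration V)) (S : Finset V) (τ β : ℝ)
    (z : Decoration V) : ℝ :=
  ∑ i, (-Real.log τ - Real.log (likelyVolume P S τ β z i))

theorem weight_nonneg (hτ : 0 < τ) (hτ1 : τ ≤ 1) (hβ : 0 < β) (hβ1 : β ≤ 1) (z : Decoration V)
    (i : V) : 0 ≤ -Real.log τ - Real.log (likelyVolume P S τ β z i) := by
  have h1 := Real.log_nonpos hτ.le hτ1
  have h2 := Real.log_nonpos (likelyVolume_pos (P := P) (S := S) (τ := τ) hβ z i).le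
    (likelyVolume_le_one hβ1 z i)
  linarith

/-- Markov's inequality for the unlikely share of the total weight. The weights and their total
depend only on the values on S, so each coordinate enters with at most τ times its mean share, and
the shares sum to at most 1. -/
theorem volume_unlikelyWeight_le (hP : MeasurableSet P) (hτ : 0 < τ) (hτ1 : τ ≤ 1) (hβ : 0 < β)
    (hβ1 : β ≤ 1) {κ : ℝ} (hκ : 0 < κ) :
    κ * volume.real {z | z ∈ P ∧ κ * totalWeight P S τ β z < unlikelyWeight P S τ β z} ≤
      τ * volume.real P := by
  set w : V → Decoration V → ℝ := fun i z => -Real.log τ - Real.log (likelyVolume P S τ β z i)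
    with hw
  have w0 : ∀ i z, 0 ≤ w i z := fun i z => weight_nonneg hτ hτ1 hβ hβ1 z i
  have wm : ∀ i, Measurable (w i) := fun i =>
    measurable_const.sub (Real.measurable_log.comp (measurable_likelyVolume hP S τ β i))
  have Wm : Measurable (totalWeight P S τ β) := Finset.measurable_fun_sum _ fun i _ => wm i
  have W0 : ∀ z, 0 ≤ totalWeight P S τ β z := fun z => Finset.sum_nonneg fun i _ => w0 i z
  have wW : ∀ i z, w i z ≤ totalWeight P S τ β z := fun i z =>
    Finset.single_le_sum (fun j _ => w0 j z) (Finset.mem_univ i)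
  have wind : ∀ i z z', (∀ j ∈ S, z j = z' j) → w i z = w i z' := fun i z z' h => by
    simp only [hw, likelyVolume_congr h]
  set h : V → Decoration V → ℝ := fun i z => w i z / totalWeight P S τ β z with hh
  have h0 : ∀ i z, 0 ≤ h i z := fun i z => div_nonneg (w0 i z) (W0 z)
  have h1 : ∀ i z, h i z ≤ 1 := fun i z => div_le_one_of_le₀ (wW i z) (W0 z)
  have hm : ∀ i, Measurable (h i) := fun i => (wm i).div Wm
  set G := marginalDensity P Finset.univ with hG
  have Gm : Measurable G := measurable_marginalDensity hP _
  have G0 : ∀ z, 0 ≤ G z := fun z => marginalDensity_nonneg z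
  have hint : ∀ f : Decoration V → ℝ, Measurable f → (∀ z, 0 ≤ f z) → (∀ z, f z ≤ 1) →
      Integrable (fun z => f z * G z) volume := fun f fm f0 f1 =>
    integrable_of_measurable_of_abs_le (fm.mul Gm) (C := 1) fun z => by
      rw [abs_of_nonneg (mul_nonneg (f0 z) (G0 z))]
      exact mul_le_one₀ (f1 z) (G0 z) (marginalDensity_le_one z)
  set B : V → Set (Decoration V) := fun i => {z | z i ∈ likelyValues P S τ z i}ᶜ with hB
  have Bm : ∀ i, MeasurableSet (B i) := fun i =>
    (measurableSet_mem_likelyValues_self hP S τ i).compl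
  have hBint : ∀ i, Integrable (fun z => (B i).indicator (h i) z * G z) volume := fun i =>
    hint _ ((hm i).indicator (Bm i)) (fun z => Set.indicator_nonneg (fun y _ => h0 i y) z)
      fun z => Set.indicator_le' (fun y _ => h1 i y) (fun _ _ => zero_le_one) z
  have hmk := mul_meas_ge_le_integral_of_nonneg (μ := volume)
    (f := fun z => ∑ i, (B i).indicator (h i) z * G z)
    (Eventually.of_forall fun z => Finset.sum_nonneg fun i _ =>
      mul_nonneg (Set.indicator_nonneg (fun y _ => h0 i y) z) (G0 z))
    (integrable_finsetSum _ fun i _ => hBint i) κ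
  have hsub : volume.real {z | z ∈ P ∧ κ * totalWeight P S τ β z < unlikelyWeight P S τ β z} ≤
      volume.real {z | κ ≤ ∑ i, (B i).indicator (h i) z * G z} := by
    refine measureReal_mono fun z hz => ?_
    have hGz : G z = 1 := by
      rw [hG, marginalDensity_univ, Set.indicator_of_mem hz.1]
    have hUW : unlikelyWeight P S τ β z ≤ totalWeight P S τ β z :=
      Finset.sum_le_sum fun i _ => Set.indicator_le' (fun _ _ => le_rfl) (fun _ _ => w0 i z) _
    have hlt : κ * totalWeight P S τ β z < unlikelyWeight P S τ β z := hz.2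
    have hWpos : 0 < totalWeight P S τ β z :=
      lt_of_lt_of_le (lt_of_le_of_lt (mul_nonneg hκ.le (W0 z)) hlt) hUW
    have heq : ∑ i, (B i).indicator (h i) z * G z =
        unlikelyWeight P S τ β z / totalWeight P S τ β z := by
      rw [unlikelyWeight, Finset.sum_div]
      refine Finset.sum_congr rfl fun i _ => ?_
      rw [hGz, mul_one]
      by_cases hzi : z i ∈ likelyValues P S τ z i
      · rw [Set.indicator_of_notMem (by simpa [hB] using hzi),
          Set.indicator_of_notMem (by simpa using hzi), zero_div]
      · rw [Set.indicator_of_mem (by simpa [hB] using hzi),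
          Set.indicator_of_mem (by simpa using hzi)]
    show κ ≤ _
    rw [heq, le_div_iff₀ hWpos]
    exact hlt.le
  refine (mul_le_mul_of_nonneg_left hsub hκ.le).trans (hmk.trans ?_)
  rw [integral_finsetSum _ fun i _ => hBint i]
  calc ∑ i, ∫ z, (B i).indicator (h i) z * G z ≤ ∑ i, τ * ∫ z, h i z * G z := by
        refine Finset.sum_le_sum fun i _ => integral_unlikely_le hP hτ.le i (hm i) (h0 i) (h1 i) ?_
        intro x y hxy
        simp only [hh, wind i x y hxy, totalWeight, likelyVolume_congr hxy]
    _ = τ * ∫ z, ∑ i, h i z * G z := by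
        rw [← Finset.mul_sum, integral_finsetSum _ fun i _ => hint _ (hm i) (h0 i) (h1 i)]
    _ ≤ τ * ∫ z, G z := by
        refine mul_le_mul_of_nonneg_left (integral_mono
          (integrable_finsetSum _ fun i _ => hint _ (hm i) (h0 i) (h1 i))
          (integrable_marginalDensity hP _) fun z => ?_) hτ.le
        simp only
        rw [← Finset.sum_mul]
        refine mul_le_of_le_one_left (G0 z) ?_
        rw [← Finset.sum_div]
        exact div_self_le_one _
    _ = τ * volume.real P := by rw [integral_marginalDensity hP]

theorem measurable_unlikelyWeight (hP : MeasurableSet P) (S : Finset V) (τ β : ℝ) :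
    Measurable (unlikelyWeight P S τ β) := by
  refine Finset.measurable_fun_sum _ fun i _ => ?_
  have : (fun z : Decoration V => (likelyValues P S τ z i)ᶜ.indicator
      (fun _ => -Real.log τ - Real.log (likelyVolume P S τ β z i)) (z i)) =
      ({z | z i ∈ likelyValues P S τ z i}ᶜ).indicator
        fun z => -Real.log τ - Real.log (likelyVolume P S τ β z i) := by
    funext z
    by_cases hz : z i ∈ likelyValues P S τ z i <;> simp [hz]
  rw [this]
  exact (measurable_const.sub
    (Real.measurable_log.comp (measurable_likelyVolume hP S τ β i))).indicator
    (measurableSet_mem_likelyValues_self hP S τ i).compl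

/-- If boxes of small average excess are small, then so is `P`, provided that there is a suitable
set `S` of coordinates to condition on. -/
theorem volume_le_of_boxes_le (hP : MeasurableSet P) {Q : Set (Decoration W)}
    (hQ : MeasurableSet Q) {E : Finset (W ↪ V)}
    (hE : ∀ φ ∈ E, ∀ x ∈ P, (fun k => x (φ k)) ∈ Q) {δ δ' η : ℝ} (hτ : 0 < τ)
    (hτ4 : 4 * τ < 1) (hβ : 0 < β) (hβ1 : β ≤ 1) (hη : 0 < η)
    (hbox : ∀ b : Set (Decoration V), IsBox b →
      (∑ φ ∈ E, (volume (projection φ b \ Q)).toReal) / (E.card : ℝ) < η → volume.real b ≤ β)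
    (htouch : ((E.filter fun φ => ∃ k, φ k ∈ S).card : ℝ) ≤ δ * E.card)
    (hstab : ∑ φ ∈ E, ∑ k, (energy P (φ k) ((S ∪ (Finset.univ.image φ).erase (φ k)).erase (φ k)) -
      energy P (φ k) (S.erase (φ k))) ≤ δ' * E.card * volume.real P)
    (hδ : δ + (2 / τ) ^ Fintype.card W * (24 / τ ^ 2) * δ' ≤ η / 4) :
    volume.real P ≤ 2 * Real.exp ((1 - 4 * τ) * Real.log β +
      Fintype.card V * (-Real.log (1 - τ) - 4 * τ * Real.log τ)) := by
  have hv : 0 ≤ volume.real P := measureReal_nonneg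
  set ex : Decoration V → ℝ := fun z => (∑ φ ∈ E, likelyExcess P S τ Q φ z) / (E.card : ℝ)
    with hexdef
  have exm : Measurable ex :=
    (Finset.measurable_fun_sum _ fun φ _ => measurable_likelyExcess hP S τ hQ φ).div_const _
  have ex0 : ∀ z, 0 ≤ ex z := fun z =>
    div_nonneg (Finset.sum_nonneg fun φ _ => likelyExcess_nonneg z) (Nat.cast_nonneg _)
  have ex1 : ∀ z, ex z ≤ 1 := fun z => by
    refine div_le_one_of_le₀ ?_ (Nat.cast_nonneg _)
    simpa using Finset.sum_le_card_nsmul E (fun φ => likelyExcess P S τ Q φ z) 1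
      fun φ _ => likelyExcess_le_one z
  have exind : ∀ z z', (∀ j ∈ S, z j = z' j) → ex z = ex z' := fun z z' h => by
    simp only [hexdef, likelyExcess_congr h]
  have hGm : Measurable (marginalDensity P Finset.univ) := measurable_marginalDensity hP _
  -- The integral of the excess over P is at most η/4 · vol P, so the threshold η discards at most a
  -- quarter of P.
  have hbad1 : volume.real {z | z ∈ P ∧ η ≤ ex z} ≤ volume.real P / 4 := by
    have hiexc : ∀ φ : W ↪ V, Integrable
        (fun z => likelyExcess P S τ Q φ z * marginalDensity P Finset.univ z) volume := fun φ =>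
      integrable_of_measurable_of_abs_le ((measurable_likelyExcess hP S τ hQ φ).mul hGm) (C := 1)
        fun z => by
          rw [abs_of_nonneg (mul_nonneg (likelyExcess_nonneg z) (marginalDensity_nonneg z))]
          exact mul_le_one₀ (likelyExcess_le_one z) (marginalDensity_nonneg z)
            (marginalDensity_le_one z)
    have heq : (fun z => ex z * marginalDensity P Finset.univ z) = fun z =>
        (∑ φ ∈ E, likelyExcess P S τ Q φ z * marginalDensity P Finset.univ z) / (E.card : ℝ) := by
      funext z
      rw [hexdef]
      simp only
      rw [← Finset.sum_mul]
      ring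
    have hmk := mul_meas_ge_le_integral_of_nonneg (μ := volume)
      (f := fun z => ex z * marginalDensity P Finset.univ z)
      (Eventually.of_forall fun z => mul_nonneg (ex0 z) (marginalDensity_nonneg z))
      (by rw [heq]; exact (integrable_finsetSum _ fun φ _ => hiexc φ).div_const _) η
    have hint : ∫ z, ex z * marginalDensity P Finset.univ z ≤ η / 4 * volume.real P := by
      rw [heq, integral_div, integral_finsetSum _ fun φ _ => hiexc φ]
      simp_rw [integral_likelyExcess_mul hP hQ]
      refine div_le_of_le_mul₀ (Nat.cast_nonneg _) (by positivity) ?_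
      refine (sum_integral_likelyExcess_le hP hQ hE hτ (by linarith) htouch hstab).trans ?_
      calc _ ≤ η / 4 * E.card * volume.real P := by gcongr
        _ = _ := by ring
    have hsub : volume.real {z | z ∈ P ∧ η ≤ ex z} ≤
        volume.real {z | η ≤ ex z * marginalDensity P Finset.univ z} := by
      refine measureReal_mono fun z hz => ?_
      show η ≤ _
      rw [marginalDensity_univ, Set.indicator_of_mem hz.1, mul_one]
      exact hz.2
    have := (mul_le_mul_of_nonneg_left hsub hη.le).trans (hmk.trans hint)
    nlinarith
  -- The unlikely share has mean at most τ, so the threshold 4τ discards at most another quarter.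
  have hbad2 : volume.real
      {z | z ∈ P ∧ 4 * τ * totalWeight P S τ β z < unlikelyWeight P S τ β z} ≤
      volume.real P / 4 := by
    have := volume_unlikelyWeight_le (S := S) hP hτ (by linarith) hβ hβ1
      (κ := 4 * τ) (by linarith)
    nlinarith
  set P' : Set (Decoration V) := {z | z ∈ P ∧ ex z < η ∧
    unlikelyWeight P S τ β z ≤ 4 * τ * totalWeight P S τ β z} with hP'
  have Wm : Measurable (totalWeight P S τ β) := Finset.measurable_fun_sum _ fun i _ =>
    measurable_const.sub (Real.measurable_log.comp (measurable_likelyVolume hP S τ β i))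
  have hP'm : MeasurableSet P' := hP.inter ((measurableSet_lt exm measurable_const).inter
    (measurableSet_le (measurable_unlikelyWeight hP S τ β) (Wm.const_mul _)))
  have hhalf : volume.real P ≤ 2 * volume.real P' := by
    have hcov : P ⊆ P' ∪ ({z | z ∈ P ∧ η ≤ ex z} ∪
        {z | z ∈ P ∧ 4 * τ * totalWeight P S τ β z < unlikelyWeight P S τ β z}) := by
      intro z hz
      by_cases h1 : η ≤ ex z
      · exact Or.inr (Or.inl ⟨hz, h1⟩)
      · by_cases h2 : 4 * τ * totalWeight P S τ β z < unlikelyWeight P S τ β z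
        · exact Or.inr (Or.inr ⟨hz, h2⟩)
        · exact Or.inl ⟨hz, not_le.1 h1, not_lt.1 h2⟩
    have h3 := (measureReal_mono (μ := volume) hcov).trans (measureReal_union_le _ _)
    have h4 := measureReal_union_le (μ := volume) {z | z ∈ P ∧ η ≤ ex z}
      {z | z ∈ P ∧ 4 * τ * totalWeight P S τ β z < unlikelyWeight P S τ β z}
    linarith
  refine hhalf.trans (mul_le_mul_of_nonneg_left ?_ zero_le_two)
  set M := Real.exp ((1 - 4 * τ) * Real.log β +
      Fintype.card V * (-Real.log (1 - τ) - 4 * τ * Real.log τ)) with hM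
  -- The box and its excess depend only on the values on S. Either the slice of P' is empty or the
  -- box has small excess, hence volume at most β, and the slice consists of points with few
  -- exceptions to it.
  have hslice : ∀ z, marginalDensity P' S z ≤ M := by
    intro z
    by_cases hne : ∃ x, S.piecewise z x ∈ P'
    swap
    · push Not at hne
      have : {x | S.piecewise z x ∈ P'} = ∅ := Set.eq_empty_of_forall_notMem hne
      rw [marginalDensity, this, measureReal_empty]
      exact (Real.exp_pos _).le
    have hagree : ∀ x, ∀ j ∈ S, S.piecewise z x j = z j := fun x j hj =>
      Finset.piecewise_eq_of_mem _ _ _ hj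
    have hexz : ex z < η := by
      obtain ⟨x, hx⟩ := hne
      rw [← exind _ _ (hagree x)]
      exact hx.2.1
    have hbz : ∏ i, volume.real (likelyValues P S τ z i) ≤ β :=
      volume_box_le hbox hQ (fun i => measurableSet_likelyValues hP S τ z i) hexz
    have hαβ := prod_likelyVolume_le hβ hβ1 hbz
    have hfew := volume_fewExceptions_le (κ := 4 * τ)
      (fun i => measurableSet_likelyValues hP S τ z i)
      (likelyVolume_pos hβ z) (volume_likelyValues_le_likelyVolume hβ z) hτ (by linarith)
    have hsub : marginalDensity P' S z ≤ volume.real {x : Decoration V |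
        ∑ i, (likelyValues P S τ z i)ᶜ.indicator
          (fun _ => -Real.log τ - Real.log (likelyVolume P S τ β z i)) (x i) ≤
        4 * τ * ∑ i, (-Real.log τ - Real.log (likelyVolume P S τ β z i))} := by
      refine measureReal_mono fun x hx => ?_
      have h2 : unlikelyWeight P S τ β (S.piecewise z x) ≤
          4 * τ * totalWeight P S τ β (S.piecewise z x) := hx.2.2
      simp only [unlikelyWeight, totalWeight, likelyVolume_congr (hagree x),
        likelyValues_congr (hagree x)] at h2
      refine le_trans (le_of_eq (Finset.sum_congr rfl fun i _ => ?_)) h2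
      -- For i ∈ S all values count as likely, so the free value x i may replace the fixed one.
      by_cases hi : i ∈ S
      · rw [Set.indicator_of_notMem, Set.indicator_of_notMem] <;> simp [likelyValues, hi]
      · rw [Finset.piecewise_eq_of_notMem _ _ _ hi]
    refine hsub.trans (hfew.trans (Real.exp_le_exp.2 ?_))
    have hlog : ∑ i, Real.log (likelyVolume P S τ β z i) ≤ Real.log β := by
      rw [← Real.log_prod fun i _ => (likelyVolume_pos hβ z i).ne']
      exact Real.log_le_log (Finset.prod_pos fun i _ => likelyVolume_pos hβ z i) hαβ
    have hsum : ∑ i, (Real.log (likelyVolume P S τ β z i) - Real.log (1 - τ) +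
        4 * τ * (-Real.log τ - Real.log (likelyVolume P S τ β z i))) =
        (1 - 4 * τ) * ∑ i, Real.log (likelyVolume P S τ β z i) +
        Fintype.card V * (-Real.log (1 - τ) - 4 * τ * Real.log τ) := by
      rw [Finset.mul_sum, ← nsmul_eq_mul, ← Finset.card_univ, ← Finset.sum_const,
        ← Finset.sum_add_distrib]
      exact Finset.sum_congr rfl fun i _ => by ring
    rw [hsum]
    have : 0 ≤ 1 - 4 * τ := by linarith
    gcongr
  rw [← integral_marginalDensity hP'm S]
  calc ∫ z, marginalDensity P' S z ≤ ∫ _z : Decoration V, M :=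
        integral_mono (integrable_marginalDensity hP'm S) (integrable_const _) hslice
    _ = M := by simp

end Saturation

/-! ### Counting overlapping links and choosing the conditioning set. -/

section Overlaps

/-- The second embedding is the first one composed with a self-map of W. -/
theorem card_pairs_same_range_le {V W : Type u} [Fintype W] (E : Finset (W ↪ V)) (D : Finset ((W ↪ V) × (W ↪ V)))
    (hD : ∀ p ∈ D, p.1 ∈ E ∧ Set.range p.2 ⊆ Set.range p.1) :
    D.card ≤ Fintype.card W ^ Fintype.card W * E.card := by
  classical
  have h := Finset.card_le_card_of_surjOn (s := E ×ˢ (Finset.univ : Finset (W → W))) (t := D)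
    (fun p => (p.1, if h : Function.Injective (p.1 ∘ p.2) then ⟨p.1 ∘ p.2, h⟩ else p.1)) ?_
  · rw [Finset.card_product, Finset.card_univ, Fintype.card_fun, mul_comm] at h
    exact h
  · rintro ⟨φ, ψ⟩ hp
    obtain ⟨h1, h2⟩ := hD _ hp
    have : ∀ k, ∃ j, φ j = ψ k := fun k => h2 ⟨k, rfl⟩
    choose g hg using this
    have hfun : (φ : W → V) ∘ g = ψ := funext hg
    refine ⟨(φ, g), by simpa using h1, ?_⟩
    have hinj : Function.Injective ((φ : W → V) ∘ g) := by
      rw [hfun]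
      exact ψ.injective
    refine Prod.ext rfl ?_
    simp only [hinj, dif_pos]
    ext k
    exact hg k

variable {V W : Type u} [DecidableEq V] [Fintype W]

-- Two links at a common vertex that intersect give images with two common points: the vertex, and a
-- point of both links, which exclude the vertex.
open Classical in
theorem overlapCount_le (E : Finset (W ↪ V)) :
    overlapCount (E ×ˢ (Finset.univ : Finset W)) (fun f => f.1 f.2)
      (fun f => (Finset.univ.image f.1).erase (f.1 f.2)) ≤
      ((E ×ˢ E).filter fun p => 1 < (Set.range p.1 ∩ Set.range p.2).ncard).card *
        (Fintype.card W * Fintype.card W) := by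
  rw [overlapCount, ← Fintype.card_prod, ← Finset.card_univ, ← Finset.card_product]
  refine Finset.card_le_card_of_injOn (fun q => ((q.1.1, q.2.1), (q.1.2, q.2.2))) ?_ ?_
  · rintro ⟨⟨φ, k⟩, ⟨ψ, l⟩⟩ hq
    simp only [Finset.coe_filter, Finset.mem_product, Finset.mem_univ, and_true,
      Set.mem_ofPred_eq] at hq
    obtain ⟨⟨h1, h2⟩, h3, h4⟩ := hq
    obtain ⟨i, hi, hi'⟩ := Finset.not_disjoint_iff.1 h4
    obtain ⟨hik, hi1⟩ := Finset.mem_erase.1 hi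
    obtain ⟨-, hi2⟩ := Finset.mem_erase.1 hi'
    simp only [Finset.mem_image, Finset.mem_univ, true_and] at hi1 hi2
    simp only [Finset.coe_product, Finset.coe_univ, Set.mem_prod, Set.mem_univ, and_true,
      Finset.coe_filter, Finset.mem_product, Set.mem_ofPred_eq]
    refine ⟨⟨h1, h2⟩, (Set.one_lt_ncard (Set.toFinite _)).2
      ⟨φ k, ⟨⟨k, rfl⟩, ⟨l, h3.symm⟩⟩, i, ⟨hi1, hi2⟩, fun h => hik h.symm⟩⟩
  · rintro ⟨⟨φ, k⟩, ⟨ψ, l⟩⟩ - ⟨⟨φ', k'⟩, ⟨ψ', l'⟩⟩ - h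
    simp only [Prod.mk.injEq] at h ⊢
    tauto

end Overlaps

/-- Pairs with equal images are not counted by I(N, n) and form the second term. -/
theorem SSEE.card_intersecting_pairs_le (S : SSEE.{u}) (N n : ℕ)
    [DecidablePred fun p : (S.V N ↪ S.V n) × (S.V N ↪ S.V n) =>
      1 < (Set.range p.1 ∩ Set.range p.2).ncard] :
    ((S.emb N n ×ˢ S.emb N n).filter
        fun p => 1 < (Set.range p.1 ∩ Set.range p.2).ncard).card ≤
      S.intersectingSum N n +
        Fintype.card (S.V N) ^ Fintype.card (S.V N) * (S.emb N n).card := by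
  classical
  set r := Fintype.card (S.V N) with hr
  set D : ℕ → Finset ((S.V N ↪ S.V n) × (S.V N ↪ S.V n)) := fun i =>
    (S.emb N n ×ˢ S.emb N n).filter fun p => (Set.range p.1 ∩ Set.range p.2).ncard = i with hD
  have hcount : ∀ i, S.intersectingCount i N N n = (D i).card := by
    intro i
    rw [SSEE.intersectingCount, ← Set.ncard_coe_finset]
    congr 1
    ext p
    simp [hD, and_assoc]
  have hrange : ∀ φ : S.V N ↪ S.V n, (Set.range φ).ncard = r := fun φ => by
    rw [← Set.image_univ, Set.ncard_image_of_injective _ φ.injective, Set.ncard_univ,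
      Nat.card_eq_fintype_card]
  have hle : ∀ p : (S.V N ↪ S.V n) × (S.V N ↪ S.V n),
      (Set.range p.1 ∩ Set.range p.2).ncard ≤ r := fun p => by
    rw [← hrange p.1]
    exact Set.ncard_le_ncard Set.inter_subset_left (Set.toFinite _)
  have hsub : ((S.emb N n ×ˢ S.emb N n).filter
      fun p => 1 < (Set.range p.1 ∩ Set.range p.2).ncard) ⊆
      (Finset.Ioo 1 r).biUnion D ∪ D r := by
    intro p hp
    obtain ⟨hp1, hp2⟩ := Finset.mem_filter.1 hp
    rcases (hle p).eq_or_lt with h | h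
    · exact Finset.mem_union_right _ (Finset.mem_filter.2 ⟨hp1, h⟩)
    · exact Finset.mem_union_left _ (Finset.mem_biUnion.2
        ⟨_, Finset.mem_Ioo.2 ⟨hp2, h⟩, Finset.mem_filter.2 ⟨hp1, rfl⟩⟩)
  refine (Finset.card_le_card hsub).trans ((Finset.card_union_le _ _).trans ?_)
  refine add_le_add ?_ (card_pairs_same_range_le _ _ fun p hp => ?_)
  · refine Finset.card_biUnion_le.trans (le_of_eq ?_)
    rw [SSEE.intersectingSum]
    exact Finset.sum_congr rfl fun i _ => (hcount i).symm
  · obtain ⟨hp1, hp2⟩ := Finset.mem_filter.1 hp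
    refine ⟨(Finset.mem_product.1 hp1).1, ?_⟩
    have h : Set.range p.1 ∩ Set.range p.2 = Set.range p.2 :=
      Set.eq_of_subset_of_ncard_le Set.inter_subset_right (by rw [hrange, hp2]) (Set.toFinite _)
    rw [← h]
    exact Set.inter_subset_left

/-- The cost of T is the number of embeddings meeting it. With penalty |W|/δ, a penalised cost of at
most |W||E| means at most δ|E| embeddings. A random R costs at most |W|q|E| on average, so by the
choice of q the penalty and the deviation each account for δ'/2. -/
theorem exists_conditioning_set {V W : Type u} [Fintype V] [DecidableEq V] [Fintype W]
    {P : Set (Decoration V)} (hP : MeasurableSet P) (hv : 0 < volume.real P)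
    (E : Finset (W ↪ V)) {δ δ' q : ℝ} (hδ : 0 < δ) (hδ' : 0 < δ') (hq : 0 < q) (hq1 : q ≤ 1)
    (hW : 0 < Fintype.card W) (hqδ : (Fintype.card W : ℝ) ^ 2 * q ≤ δ * (δ' / 2))
    (hO : (Fintype.card V : ℝ) * overlapCount (E ×ˢ (Finset.univ : Finset W)) (fun f => f.1 f.2)
      (fun f => (Finset.univ.image f.1).erase (f.1 f.2)) ≤
      (δ' / 2 * E.card * q ^ (Fintype.card W - 1)) ^ 2) :
    ∃ S : Finset V, ((E.filter fun φ => ∃ k, φ k ∈ S).card : ℝ) ≤ δ * E.card ∧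
      ∑ φ ∈ E, ∑ k, (energy P (φ k) ((S ∪ (Finset.univ.image φ).erase (φ k)).erase (φ k)) -
        energy P (φ k) (S.erase (φ k))) ≤ δ' * E.card * volume.real P := by
  have hW' : (0 : ℝ) < Fintype.card W := Nat.cast_pos.2 hW
  obtain ⟨S, hS1, hS2⟩ := exists_cheap_stable_set (F := E ×ˢ (Finset.univ : Finset W))
    (v := fun f => f.1 f.2) (L := fun f => (Finset.univ.image f.1).erase (f.1 f.2))
    (s := Fintype.card W - 1) (fun f _ => by
      rw [Finset.card_erase_of_mem (by simp), Finset.card_image_of_injective _ f.1.injective,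
        Finset.card_univ])
    -- Erasing i makes this monotone on all sets; division by vol P puts it in [0,1].
    (Φ := fun i T => energy P i (T.erase i) / volume.real P)
    (fun i T T' h => div_le_div_of_nonneg_right (energy_mono hP (Finset.erase_subset_erase _ h)
      (Finset.notMem_erase _ _)) hv.le)
    (fun i T => div_nonneg (energy_nonneg i) hv.le)
    (fun i T => div_le_one_of_le₀ (energy_le hP i) hv.le)
    (t := fun T => ((E.filter fun φ => ∃ k, φ k ∈ T).card : ℝ)) (by simp)
    (fun T R => by
      rw [← Nat.cast_add, Nat.cast_le]
      refine (Finset.card_le_card fun φ hφ => ?_).trans (Finset.card_union_le _ _)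
      obtain ⟨h1, k, hk⟩ := Finset.mem_filter.1 hφ
      rcases Finset.mem_union.1 hk with h | h
      · exact Finset.mem_union_left _ (Finset.mem_filter.2 ⟨h1, k, h⟩)
      · exact Finset.mem_union_right _ (Finset.mem_filter.2 ⟨h1, k, h⟩))
    (lam := Fintype.card W / δ) (div_nonneg hW'.le hδ.le) hq hq1
    (B := Fintype.card W * q * E.card) (by
      calc ∑ R, randomSubsetWeight q R * ((E.filter fun φ => ∃ k, φ k ∈ R).card : ℝ)
          ≤ ∑ R, randomSubsetWeight q R *
              ∑ φ ∈ E, ∑ k, (if ({φ k} : Finset V) ⊆ R then (1 : ℝ) else 0) := by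
            refine Finset.sum_le_sum fun R _ => mul_le_mul_of_nonneg_left ?_
              (randomSubsetWeight_nonneg hq.le hq1 R)
            rw [Finset.card_filter, Nat.cast_sum]
            refine Finset.sum_le_sum fun φ _ => ?_
            have h0 : ∀ k ∈ Finset.univ, (0 : ℝ) ≤ if ({φ k} : Finset V) ⊆ R then 1 else 0 :=
              fun k _ => by split_ifs <;> norm_num
            split_ifs with h
            · obtain ⟨k, hk⟩ := h
              refine le_trans ?_ (Finset.single_le_sum h0 (Finset.mem_univ k))
              simp [hk]
            · exact_mod_cast Finset.sum_nonneg h0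
        _ = ∑ φ ∈ E, ∑ k : W, ∑ R, randomSubsetWeight q R *
              (if ({φ k} : Finset V) ⊆ R then (1 : ℝ) else 0) := by
            simp_rw [Finset.mul_sum]
            rw [Finset.sum_comm]
            exact Finset.sum_congr rfl fun φ _ => Finset.sum_comm
        _ = Fintype.card W * q * E.card := by
            simp_rw [sum_randomSubsetWeight_superset]
            simp
            ring
        _ ≤ _ := le_rfl)
    (C := δ' / 2 * E.card) (by positivity) hO
  refine ⟨S, ?_, ?_⟩
  · rw [Finset.card_product, Finset.card_univ, Nat.cast_mul, div_mul_eq_mul_div,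
      div_le_iff₀ hδ] at hS1
    refine le_of_mul_le_mul_left ?_ hW'
    linarith
  · have hsum : ∑ φ ∈ E, ∑ k,
        (energy P (φ k) ((S ∪ (Finset.univ.image φ).erase (φ k)).erase (φ k)) -
          energy P (φ k) (S.erase (φ k))) = volume.real P *
        ∑ f ∈ E ×ˢ (Finset.univ : Finset W),
          (energy P (f.1 f.2) ((S ∪ (Finset.univ.image f.1).erase (f.1 f.2)).erase (f.1 f.2)) /
            volume.real P - energy P (f.1 f.2) (S.erase (f.1 f.2)) / volume.real P) := by
      rw [Finset.sum_product, Finset.mul_sum]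
      refine Finset.sum_congr rfl fun φ _ => ?_
      rw [Finset.mul_sum]
      refine Finset.sum_congr rfl fun k _ => ?_
      field_simp
    rw [hsum, mul_comm]
    refine mul_le_mul_of_nonneg_right (hS2.trans ?_) hv.le
    have : (Fintype.card W : ℝ) / δ * (Fintype.card W * q * E.card) ≤ δ' / 2 * E.card := by
      rw [div_mul_eq_mul_div, div_le_iff₀ hδ]
      calc (Fintype.card W : ℝ) * (Fintype.card W * q * E.card)
          = (Fintype.card W : ℝ) ^ 2 * q * E.card := by ring
        _ ≤ δ * (δ' / 2) * E.card := by gcongr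
        _ = _ := by ring
    linarith

/-! ### Entropy versus volume, and the choice of τ. -/

theorem entropy_eq_neg_log {V : Type u} [Fintype V] {b : Set (Decoration V)}
    (hb : 0 < volume.real b) : entropy b = ((-Real.log (volume.real b) : ℝ) : EReal) := by
  rw [entropy, ENNReal.log_pos_real' hb]
  rfl

theorem volume_le_exp_of_lt_entropy {V : Type u} [Fintype V] {b : Set (Decoration V)} {c : ℝ}
    (h : ((c : ℝ) : EReal) < entropy b) : volume.real b ≤ Real.exp (-c) := by
  rcases (measureReal_nonneg (μ := volume) (s := b)).eq_or_lt with h0 | h0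
  · rw [← h0]
    exact (Real.exp_pos _).le
  · rw [entropy_eq_neg_log h0, EReal.coe_lt_coe_iff] at h
    rw [← Real.log_le_iff_le_exp h0]
    linarith

theorem exp_lt_volume_of_entropy_lt {V : Type u} [Fintype V] {b : Set (Decoration V)} {c : ℝ}
    (h : entropy b < ((c : ℝ) : EReal)) : Real.exp (-c) < volume.real b := by
  rcases (measureReal_nonneg (μ := volume) (s := b)).eq_or_lt with h0 | h0
  · exfalso
    have : volume b = 0 := by
      rcases (ENNReal.toReal_eq_zero_iff _).1 h0.symm with h1 | h1
      · exact h1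
      · exact absurd h1 (measure_ne_top _ _)
    simp [entropy, this] at h
  · rw [entropy_eq_neg_log h0, EReal.coe_lt_coe_iff] at h
    rw [← Real.lt_log_iff_exp_lt h0]
    linarith

theorem exp_lt_volume_of_extremalEntropy_lt {V : Type u} [Fintype V] {Q : Set (Decoration V)}
    {c : ℝ} (h : extremalEntropy Q < ((c : ℝ) : EReal)) : Real.exp (-c) < volume.real Q := by
  obtain ⟨_, ⟨b, -, hb, rfl⟩, hlt⟩ := sInf_lt_iff.1 h
  refine (exp_lt_volume_of_entropy_lt hlt).trans_le ?_
  have h1 : volume.real b ≤ volume.real (Q ∪ b \ Q) :=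
    measureReal_mono fun x hx => (em (x ∈ Q)).imp id fun hxQ => ⟨hx, hxQ⟩
  have h2 : volume.real (b \ Q) = 0 := by rw [Measure.real, hb, ENNReal.toReal_zero]
  linarith [measureReal_union_le (μ := volume) Q (b \ Q)]

/-- The left side of the last inequality is the loss per coordinate in `volume_le_of_boxes_le` for β
= e^{-γ|V|}; it tends to 0 with τ because τ log τ does. -/
theorem exists_small_threshold (γ : ℝ) {ε : ℝ} (hε : 0 < ε) :
    ∃ τ : ℝ, 0 < τ ∧ 4 * τ < 1 ∧
      4 * τ * γ + (-Real.log (1 - τ) - 4 * τ * Real.log τ) < ε := by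
  have h1 : Tendsto (fun τ : ℝ => 4 * τ * γ + (-Real.log (1 - τ) - 4 * (τ * Real.log τ)))
      (𝓝 0) (𝓝 (4 * 0 * γ + (-Real.log (1 - 0) - 4 * (0 * Real.log 0)))) := by
    have hlog : ContinuousAt (fun τ : ℝ => Real.log (1 - τ)) 0 :=
      ContinuousAt.log (by fun_prop) (by norm_num)
    have hml : ContinuousAt (fun τ : ℝ => τ * Real.log τ) 0 :=
      Real.continuous_mul_log.continuousAt
    exact ContinuousAt.tendsto (f := fun τ : ℝ =>
      4 * τ * γ + (-Real.log (1 - τ) - 4 * (τ * Real.log τ)))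
      ((by fun_prop : ContinuousAt (fun τ : ℝ => 4 * τ * γ) 0).add
        (hlog.neg.sub (continuousAt_const.mul hml)))
  simp only [mul_zero, zero_mul, sub_zero, Real.log_one, neg_zero, add_zero] at h1
  have h2 : ∀ᶠ τ : ℝ in 𝓝[>] 0,
      4 * τ * γ + (-Real.log (1 - τ) - 4 * (τ * Real.log τ)) < ε :=
    (h1.mono_left nhdsWithin_le_nhds).eventually_lt_const hε
  have h3 : ∀ᶠ τ : ℝ in 𝓝[>] 0, τ < 1 / 4 :=
    nhdsWithin_le_nhds (eventually_lt_nhds (by norm_num))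
  obtain ⟨τ, ⟨hτ1, hτ2⟩, hτ0⟩ := (h2.and h3).and self_mem_nhdsWithin |>.exists
  exact ⟨τ, hτ0, by linarith, by linarith⟩

/-! ### The upper bound for good ssees. -/

namespace SSEE

-- Pairs with partial overlap are negligible by the condition on I(N, n), and pairs with equal
-- images because |V_n| is negligible against the number of embeddings.
open Classical in
theorem IsGood.eventually_overlapCount_le {S : SSEE.{u}} (hS : S.IsGood) {N : ℕ}
    (hN : 1 < Fintype.card (S.V N)) {c : ℝ} (hc : 0 < c) :
    ∀ᶠ n in atTop, (Fintype.card (S.V n) : ℝ) *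
      (overlapCount (S.emb N n ×ˢ (Finset.univ : Finset (S.V N))) (fun f => f.1 f.2)
        (fun f => (Finset.univ.image f.1).erase (f.1 f.2)) : ℝ) ≤
        c * ((S.emb N n).card : ℝ) ^ 2 := by
  set r := Fintype.card (S.V N) with hr
  have h1 := hS.few_intersecting N hN
  have h2 := hS.many_embeddings N hN
  have h3 : Tendsto (fun n => (r : ℝ) * r * (((Fintype.card (S.V n) : ℝ) *
      (S.intersectingSum N n : ℝ)) / ((S.emb N n).card : ℝ) ^ 2 +
      (r : ℝ) ^ r * (((S.emb N n).card : ℝ) / (Fintype.card (S.V n) : ℝ))⁻¹)) atTop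
      (𝓝 ((r : ℝ) * r * (0 + (r : ℝ) ^ r * 0))) :=
    (h1.add (h2.inv_tendsto_atTop.const_mul _)).const_mul _
  simp only [mul_zero, add_zero] at h3
  filter_upwards [h3.eventually_lt_const hc, h2.eventually_gt_atTop 0] with n hn hpos
  have hE : (0 : ℝ) < (S.emb N n).card := by
    rcases (Nat.cast_nonneg (α := ℝ) (S.emb N n).card).eq_or_lt with h | h
    · rw [← h, zero_div] at hpos
      exact absurd hpos (lt_irrefl _)
    · exact h
  have hle : (overlapCount (S.emb N n ×ˢ (Finset.univ : Finset (S.V N))) (fun f => f.1 f.2)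
        (fun f => (Finset.univ.image f.1).erase (f.1 f.2)) : ℝ) ≤
      ((S.intersectingSum N n : ℝ) + (r : ℝ) ^ r * (S.emb N n).card) * (r * r) := by
    have := (overlapCount_le (S.emb N n)).trans
      (Nat.mul_le_mul_right _ (S.card_intersecting_pairs_le N n))
    exact_mod_cast this
  refine (mul_le_mul_of_nonneg_left hle (Nat.cast_nonneg _)).trans ?_
  have heq : (Fintype.card (S.V n) : ℝ) *
      (((S.intersectingSum N n : ℝ) + (r : ℝ) ^ r * (S.emb N n).card) * (r * r)) =
      (r : ℝ) * r * (((Fintype.card (S.V n) : ℝ) *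
      (S.intersectingSum N n : ℝ)) / ((S.emb N n).card : ℝ) ^ 2 +
      (r : ℝ) ^ r * (((S.emb N n).card : ℝ) / (Fintype.card (S.V n) : ℝ))⁻¹) *
      ((S.emb N n).card : ℝ) ^ 2 := by
    rw [inv_div]
    field_simp
  rw [heq]
  gcongr

open Classical in
theorem IsGood.eventually_exists_conditioning_set {S : SSEE.{u}} (hS : S.IsGood) (N : ℕ)
    {P : ∀ n, Set (Decoration (S.V n))} (hP : ∀ n, MeasurableSet (P n)) {δ δ' : ℝ}
    (hδ : 0 < δ) (hδ' : 0 < δ') :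
    ∀ᶠ n in atTop, 0 < volume.real (P n) → ∃ T : Finset (S.V n),
      (((S.emb N n).filter fun φ => ∃ k, φ k ∈ T).card : ℝ) ≤ δ * (S.emb N n).card ∧
      ∑ φ ∈ S.emb N n, ∑ k,
        (energy (P n) (φ k) ((T ∪ (Finset.univ.image φ).erase (φ k)).erase (φ k)) -
          energy (P n) (φ k) (T.erase (φ k))) ≤
        δ' * (S.emb N n).card * volume.real (P n) := by
  set r := Fintype.card (S.V N) with hr
  rcases Nat.lt_or_ge 1 r with h1 | h1
  · have hr0 : (0 : ℝ) < r := by exact_mod_cast (by lia : 0 < r)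
    set q : ℝ := min 1 (δ * (δ' / 2) / (r : ℝ) ^ 2) with hq
    have hq0 : 0 < q := lt_min one_pos (by positivity)
    filter_upwards [hS.eventually_overlapCount_le h1
      (c := (δ' / 2 * q ^ (r - 1)) ^ 2) (by positivity)] with n hn hv
    refine exists_conditioning_set (hP n) hv _ hδ hδ' hq0 (min_le_left _ _) (by lia) ?_ ?_
    · have := min_le_right 1 (δ * (δ' / 2) / (r : ℝ) ^ 2)
      rw [le_div_iff₀ (by positivity)] at this
      linarith
    · refine hn.trans (le_of_eq ?_)
      ring
  -- If V_N has at most one point all links are empty, so nothing needs to be pinned.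
  · refine Eventually.of_forall fun n hv => ⟨∅, ?_, ?_⟩
    · simp only [Finset.notMem_empty, exists_false, Finset.filter_false, Finset.card_empty,
        Nat.cast_zero]
      positivity
    · have hsub : Subsingleton (S.V N) := Fintype.card_le_one_iff_subsingleton.1 h1
      have : ∀ φ : S.V N ↪ S.V n, ∀ k, (Finset.univ.image φ).erase (φ k) = ∅ := by
        intro φ k
        ext v
        simp only [Finset.mem_erase, Finset.mem_image, Finset.mem_univ, true_and,
          Finset.notMem_empty, iff_false, not_and]
        rintro hv ⟨l, rfl⟩
        exact hv (by rw [Subsingleton.elim l k])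
      simp only [this, Finset.empty_union, Finset.erase_empty, sub_self, Finset.sum_const_zero]
      positivity

theorem IsGood.eventually_volume_le {S : SSEE.{u}} (hS : S.IsGood)
    {P : DecorationProperty S} (hP : P.IsHereditary) {π : ℝ}
    (hsat : ∀ ε : ℝ, 0 < ε → ∃ η : ℝ, 0 < η ∧ ∃ N n₀ : ℕ, 0 < N ∧ N ≤ n₀ ∧
      ∀ n, n₀ ≤ n → ∀ b : Set (Decoration (S.V n)), IsBox b →
        expectedExcess S N n b (P.body N) < η →
          (((π - ε) * (Fintype.card (S.V n) : ℝ) : ℝ) : EReal) < entropy b)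
    {ε : ℝ} (hε : 0 < ε) :
    ∀ᶠ n in atTop,
      volume.real (P.body n) ≤ Real.exp (-((π - ε) * (Fintype.card (S.V n) : ℝ))) := by
  classical
  -- Here the bound is at least 1. Otherwise γ below is positive, which gives β ≤ 1.
  by_cases hπ : π - ε ≤ 0
  · refine Eventually.of_forall fun n => measureReal_le_one.trans (Real.one_le_exp ?_)
    exact neg_nonneg.2 (mul_nonpos_of_nonpos_of_nonneg hπ (Nat.cast_nonneg _))
  -- The error ε is split into ε/2 for the box bound, ε/4 for the loss due to τ and ε/4 for the
  -- factor 2.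
  obtain ⟨η, hη, N, n₀, -, hNn, hbox⟩ := hsat (ε / 2) (half_pos hε)
  set γ := π - ε / 2 with hγ
  have hγ0 : 0 < γ := by linarith
  obtain ⟨τ, hτ, hτ4, hτε⟩ := exists_small_threshold γ (ε := ε / 4) (by linarith)
  set K := (2 / τ) ^ Fintype.card (S.V N) * (24 / τ ^ 2) with hK
  have hK0 : 0 < K := by positivity
  have hlarge : ∀ᶠ n in atTop, Real.log 2 ≤ ε / 4 * (Fintype.card (S.V n) : ℝ) :=
    ((tendsto_natCast_atTop_atTop.comp hS.card_tendsto).const_mul_atTop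
      (by linarith : 0 < ε / 4)).eventually_ge_atTop _
  -- These values make δ + Kδ' equal to η/4.
  filter_upwards [hS.eventually_exists_conditioning_set N P.measurableSet_body
    (δ := η / 8) (δ' := η / (8 * K)) (by positivity) (by positivity), hlarge,
    eventually_ge_atTop n₀] with n hn hm hn0
  rcases (measureReal_nonneg (μ := volume) (s := P.body n)).eq_or_lt with h0 | h0
  · rw [← h0]
    exact (Real.exp_pos _).le
  obtain ⟨T, hT1, hT2⟩ := hn h0
  set m : ℝ := (Fintype.card (S.V n) : ℝ) with hmdef
  have hm0 : 0 ≤ m := Nat.cast_nonneg _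
  have hher : ∀ φ ∈ S.emb N n, ∀ x ∈ P.body n, (fun k => x (φ k)) ∈ P.body N := by
    intro φ hφ x hx
    by_contra hcon
    refine hP N n (hNn.trans hn0) ?_ hx
    exact Set.mem_iUnion₂.2 ⟨φ, hφ, _, hcon, fun _ => rfl⟩
  have hβ1 : Real.exp (-(γ * m)) ≤ 1 :=
    Real.exp_le_one_iff.2 (neg_nonpos.2 (mul_nonneg hγ0.le hm0))
  have key := volume_le_of_boxes_le (S := T) (P.measurableSet_body n) (P.measurableSet_body N)
    hher hτ hτ4 (Real.exp_pos (-(γ * m))) hβ1 hη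
    (fun b hb hexc => volume_le_exp_of_lt_entropy (hbox n hn0 b hb hexc)) hT1 hT2 (by
      rw [← hK]
      field_simp
      norm_num)
  refine key.trans ?_
  rw [Real.log_exp, ← Real.exp_log (zero_lt_two' ℝ), ← Real.exp_add]
  refine Real.exp_le_exp.2 ?_
  have h1 := mul_le_mul_of_nonneg_left hτε.le hm0
  rw [← hmdef]
  nlinarith

end SSEE

/-! ### The lower bound and the conclusion. -/

theorem eventually_exp_le_volume {S : SSEE.{u}} (hS : S.IsGood) {P : DecorationProperty S} {π : ℝ}
    (hlim : Tendsto
      (fun n => extremalEntropy (P.body n) / ((Fintype.card (S.V n) : ℝ) : EReal))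
      atTop (𝓝 (π : EReal))) {ε : ℝ} (hε : 0 < ε) :
    ∀ᶠ n in atTop,
      Real.exp (-((π + ε) * (Fintype.card (S.V n) : ℝ))) < volume.real (P.body n) := by
  have h1 : (π : EReal) < ((π + ε : ℝ) : EReal) := EReal.coe_lt_coe_iff.2 (by linarith)
  filter_upwards [hlim.eventually_lt_const h1, hS.card_tendsto.eventually_gt_atTop 0] with n hn hm
  rw [EReal.div_lt_iff (EReal.coe_pos.2 (Nat.cast_pos.2 hm)) (EReal.coe_ne_top _),
    ← EReal.coe_mul] at hn
  exact exp_lt_volume_of_extremalEntropy_lt hn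

theorem mainTheorem5 (S : SSEE.{u}) (hS : S.IsGood)
    (P : DecorationProperty S) (hP : P.IsHereditary)
    (π : ℝ)
    (hlim : Tendsto
      (fun n => extremalEntropy (P.body n) / ((Fintype.card (S.V n) : ℝ) : EReal))
      atTop (𝓝 (π : EReal)))
    (hsat : ∀ ε : ℝ, 0 < ε → ∃ η : ℝ, 0 < η ∧ ∃ N n₀ : ℕ, 0 < N ∧ N ≤ n₀ ∧
      ∀ n, n₀ ≤ n → ∀ b : Set (Decoration (S.V n)), IsBox b →
        expectedExcess S N n b (P.body N) < η →
          (((π - ε) * (Fintype.card (S.V n) : ℝ) : ℝ) : EReal) < entropy b) :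
    ∃ o : ℕ → ℝ, Tendsto o atTop (𝓝 0) ∧ ∀ᶠ n in atTop,
      (volume (P.body n)).toReal =
        Real.exp (-((π + o n) * (Fintype.card (S.V n) : ℝ))) := by
  have hpos : ∀ᶠ n in atTop, (0 : ℝ) < Fintype.card (S.V n) :=
    (hS.card_tendsto.eventually_gt_atTop 0).mono fun n hn => Nat.cast_pos.2 hn
  -- The value forced by the equation; the lower bound makes the volume positive for large n, so
  -- that the logarithm is meaningful.
  refine ⟨fun n => -Real.log (volume.real (P.body n)) / (Fintype.card (S.V n) : ℝ) - π, ?_, ?_⟩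
  · rw [Metric.tendsto_nhds]
    intro ε hε
    filter_upwards [eventually_exp_le_volume hS hlim (half_pos hε),
      hS.eventually_volume_le hP hsat (half_pos hε), hpos] with n h1 h2 hm
    have hv : 0 < volume.real (P.body n) := (Real.exp_pos _).trans h1
    have h3 := (Real.lt_log_iff_exp_lt hv).2 h1
    have h4 := (Real.log_le_iff_le_exp hv).2 h2
    rw [Real.dist_eq, sub_zero, abs_lt, lt_sub_iff_add_lt, sub_lt_iff_lt_add, lt_div_iff₀ hm,
      div_lt_iff₀ hm]
    constructor <;> nlinarith [mul_pos hε hm]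
  · filter_upwards [eventually_exp_le_volume hS hlim one_pos, hpos] with n h1 hm
    have hv : 0 < volume.real (P.body n) := (Real.exp_pos _).trans h1
    rw [add_sub_cancel, div_mul_cancel₀ _ hm.ne', neg_neg, Real.exp_log hv]
    rfl
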